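/- **Theorem.** Let $A=\sum_{i=1}^n\lambda_i u_iu_i^{\mathsf H}$ be an $n\times n$ Hermitian matrix ($n\ge 1$) with orthonormal eigenvectors $u_i$ and all eigenvalues in $[a,b]$, let $f:\mathbb R\to\mathbb R$ satisfy $f_{\min}\le f(x)\le f_{\max}$ for all $x\in[a,b]$, and put $f(A)=\sum_i f(\lambda_i)u_iu_i^{\mathsf H}$. Let $n_{\mathrm v}\ge 1$ and let $v_1,\dots,v_{n_{\mathrm v}}$ be independent and uniformly distributed on the real unit sphere $\mathbb S^{n-1}\subset\mathbb R^n$. Write $\Psi_\ell=\sum_i|v_\ell^{\mathsf H}u_i|^2\delta_{\lambda_i}$, let $\langle\cdot\rangle$ denote the average over $\ell=1,\dots,n_{\mathrm v}$, and let $\|g\|_{[a,b]}=\sup_{x\in[a,b]}|g(x)|$. A choice of $\circ$ (of degree $s$) is a rule that assigns to a function $f$, possibly depending on $\Psi$, a polynomial $[f]_s^\circ$ of degree at most $s$; the quadrature approximation $[\Psi]_s^\circ$ is defined by $\int f\,d[\Psi]_s^\circ:=\int [f]_s^\circ\,d\Psi$. Put $$e_s(f,\circ)=\Big|\int f\,d\langle\Psi_\ell\rangle-\int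 f\,d\langle[\Psi_\ell]_s^\circ\rangle\Big| .$$ 1. For every $s$, every choice of $\circ$ and every $\varepsilon>0$, $$\mathbb P\Big[\Big|n^{-1}\operatorname{tr}(f(A))-\int f\,d\langle[\Psi_\ell]_s^\circ\rangle\Big|>\varepsilon+e_s(f,\circ)\Big]\le 2n\exp\Big(-\frac{n_{\mathrm v}(n+2)\varepsilon^2}{(f_{\max}-f_{\min})^2}\Big),$$ where the right-hand side is read as $0$ if $f_{\max}=f_{\min}$. 2. For every $s$ and every choice of $\circ$, and every realization of the $v_\ell$, $e_s(f,\circ)\le\langle\|f-[f]_s^\circ\|_{[a,b]}\rangle$, where $[f]^\circ_s$ in the $\ell$-th term is formed with $\Psi_\ell$ (if $[f]_s^\circ$ does not depend on $\Psi$, the right-hand side is $\|f-[f]_s^\circ\|_{[a,b]}$). 3. Let $E_s=\min_{\deg p\le s}\|f-p\|_{[a,b]}$. In each of the following cases $[\Psi_\ell]_s^\circ$ is given by a signed measure, integration of $f$ against the average of these signed measures is $\int f\,d\langle[\Psi_\ell]_s^\circ\rangle$, and, for every realization of the $v_\ell$: - ($\circ=\mathrm g$, Gaussian quadrature) for $s=2k-1$,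 $k\ge1$, where $[f]_s^{\mathrm g}$ interpolates $f$ at the zeros of the degree $k$ orthogonal polynomial of $\Psi$ (of the degree $m$ one, if $\Psi$ is supported on only $m<k$ points): $e_s(f,\mathrm g)\le 2E_s$; - ($\circ=\mathrm i$, interpolation) where $[f]_s^{\mathrm i}$ interpolates $f$ at the $s+1$ zeros of the degree $s+1$ orthogonal polynomial of $\mu$: $e_s(f,\mathrm i)\le(1+d_{\mathrm{TV}}(\langle[\Psi_\ell]_s^{\mathrm i}\rangle))E_s$; - ($\circ=\mathrm a$, approximation) where $[f]_s^{\mathrm a}=\sum_{i=0}^s(\int fp_i\,d\mu)\,p_i$ with the orthonormal polynomials $p_i$ of $\mu$, and $f$ is $\mu$-measurable: $e_s(f,\mathrm a)\le(1+d_{\mathrm{TV}}(\langle[\Psi_\ell]_s^{\mathrm a}\rangle))E_s$. In the last two cases $\mu$ is any fixed probability measure concentrated on $[a,b]$ but not on $s$ or fewer points; $d_{\mathrm{TV}}(\Upsilon)=\int|d\Upsilon|$. -/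

import Mathlib

open MeasureTheory ProbabilityTheory Polynomial
open scoped ENNReal

namespace MatrixQuad

noncomputable section

/-! ### The random vectors and the spectral measures -/

/-- The uniform probability measure on the real unit hypersphere of `ℝⁿ`. -/
def unifSphere (n : ℕ) : Measure (Metric.sphere (0 : EuclideanSpace ℝ (Fin n)) 1) :=
  ((volume : Measure (EuclideanSpace ℝ (Fin n))).toSphere Set.univ)⁻¹ •
    (volume : Measure (EuclideanSpace ℝ (Fin n))).toSphere

/-- A real vector regarded as a complex vector. -/
def toComplex {n : ℕ} (v : EuclideanSpace ℝ (Fin n)) : EuclideanSpace ℂ (Fin n) :=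
  WithLp.toLp 2 (fun j => (v j : ℂ))

/-- The weighted cumulative empirical spectral measure `Ψ` of the Hermitian matrix `A` and the
vector `v`, as the measure whose distribution function is
`x ↦ ∑ i, |vᴴ uᵢ|² 𝟙(λᵢ ≤ x)`, where `A = ∑ i, λᵢ uᵢ uᵢᴴ`. -/
def weightedCESM {n : ℕ} {A : Matrix (Fin n) (Fin n) ℂ} (hA : A.IsHermitian)
    (v : EuclideanSpace ℝ (Fin n)) : Measure ℝ :=
  ∑ i, ENNReal.ofReal (‖inner ℂ (toComplex v) (hA.eigenvectorBasis i)‖ ^ 2) •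
    Measure.dirac (hA.eigenvalues i)

/-- The average `⟨Ψ_ℓ⟩` of finitely many measures. -/
def avgMeasure {nv : ℕ} (Ψ : Fin nv → Measure ℝ) : Measure ℝ :=
  (nv : ℝ≥0∞)⁻¹ • ∑ l, Ψ l

/-- The average `⟨Υ_ℓ⟩` of finitely many signed measures. -/
def avgSigned {nv : ℕ} (Q : Fin nv → SignedMeasure ℝ) : SignedMeasure ℝ :=
  (nv : ℝ)⁻¹ • ∑ l, Q l

/-- The total variation `∫ |dΥ|` of a signed measure. -/
def dTV (Q : SignedMeasure ℝ) : ℝ := Q.variation.real Set.univ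

/-! ### Uniform norms and best approximation -/

/-- `‖g‖_{[a,b]} = sup_{x ∈ [a,b]} |g x|`. -/
def uniformNorm (a b : ℝ) (g : ℝ → ℝ) : ℝ := ⨆ x : Set.Icc a b, |g x|

/-- `‖f - [f]_s^best‖_{[a,b]}`, the least uniform error on `[a,b]` among the polynomials of degree
at most `s`. -/
def bestError (s : ℕ) (a b : ℝ) (f : ℝ → ℝ) : ℝ :=
  ⨅ p : {p : ℝ[X] // p.natDegree ≤ s}, uniformNorm a b (fun x => f x - p.1.eval x)

/-! ### Polynomial approximation operators and the induced quadrature -/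

/-- A choice of the parameter `∘`: a rule that assigns to a function `f` a polynomial `[f]_s` of
degree at most `s`. As for Gaussian quadrature, the rule may depend on the measure `Ψ` that is to
be approximated. -/
structure PolyApprox (s : ℕ) where
  toPoly : Measure ℝ → (ℝ → ℝ) → ℝ[X]
  natDegree_le : ∀ ν f, (toPoly ν f).natDegree ≤ s

/-- `∫ f d⟨[Ψ_ℓ]_s⟩`, where the quadrature approximation `[Ψ]_s` of `Ψ` is defined by
`∫ f d[Ψ]_s := ∫ [f]_s dΨ`. -/
def quadIntegral {s nv : ℕ} (T : PolyApprox s) (Ψ : Fin nv → Measure ℝ) (f : ℝ → ℝ) : ℝ :=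
  (nv : ℝ)⁻¹ * ∑ l, ∫ x, (T.toPoly (Ψ l) f).eval x ∂(Ψ l)

/-- The quadrature error `e_s(f,∘) = |∫ f d⟨Ψ_ℓ⟩ - ∫ f d⟨[Ψ_ℓ]_s⟩|`. -/
def quadError {s nv : ℕ} (T : PolyApprox s) (Ψ : Fin nv → Measure ℝ) (f : ℝ → ℝ) : ℝ :=
  |(∫ x, f x ∂(avgMeasure Ψ)) - quadIntegral T Ψ f|

/-! ### Orthogonal polynomials -/

/-- The monic orthogonal polynomials of `ν`: Gram–Schmidt, without normalization, applied to the
monomials. (A previous polynomial of norm zero contributes nothing.) -/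
def monicOrth (ν : Measure ℝ) (j : ℕ) : ℝ[X] :=
  X ^ j - ∑ i : Fin j,
    C ((∫ x, x ^ j * (monicOrth ν i).eval x ∂ν) / ∫ x, (monicOrth ν i).eval x ^ 2 ∂ν) *
      monicOrth ν i
termination_by j
decreasing_by all_goals exact i.2

/-- The orthonormal polynomials `p_j` of `ν` (with positive leading coefficient). -/
def orthonormalPoly (ν : Measure ℝ) (j : ℕ) : ℝ[X] :=
  C (√(∫ x, (monicOrth ν j).eval x ^ 2 ∂ν))⁻¹ * monicOrth ν j

theorem natDegree_monicOrth_le (ν : Measure ℝ) (j : ℕ) : (monicOrth ν j).natDegree ≤ j := by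
  induction j using Nat.strong_induction_on with
  | _ j ih =>
    rw [monicOrth]
    refine (natDegree_sub_le _ _).trans (max_le (natDegree_X_pow_le j) ?_)
    refine natDegree_sum_le_of_forall_le _ _ (fun i _ => ?_)
    exact (natDegree_C_mul_le _ _).trans ((ih i i.2).trans i.2.le)

theorem natDegree_orthonormalPoly_le (ν : Measure ℝ) (j : ℕ) :
    (orthonormalPoly ν j).natDegree ≤ j :=
  (natDegree_C_mul_le _ _).trans (natDegree_monicOrth_le ν j)

/-- The zeros `θ_1, …, θ_j` of the degree `j` orthogonal polynomial of `ν`. -/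
def orthNodes (ν : Measure ℝ) (j : ℕ) : Finset ℝ := (monicOrth ν j).roots.toFinset

theorem card_orthNodes_le (ν : Measure ℝ) (j : ℕ) : (orthNodes ν j).card ≤ j :=
  (Multiset.toFinset_card_le _).trans ((card_roots' _).trans (natDegree_monicOrth_le ν j))

/-! ### Quadrature by interpolation at given nodes -/

/-- The polynomial of least degree that interpolates `f` at the nodes `t`. -/
def nodeInterp (t : Finset ℝ) (f : ℝ → ℝ) : ℝ[X] := Lagrange.interpolate t id f

/-- The interpolatory quadrature rule `∑_{θ ∈ t} ω_θ δ_θ` for `ν` at the nodes `t`; the weights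
`ω_θ`, the integrals of the Lagrange basis polynomials, are those for which the rule and `ν`
integrate every polynomial of degree less than `#t` to the same value. -/
def nodeMeasure (t : Finset ℝ) (ν : Measure ℝ) : SignedMeasure ℝ :=
  ∑ θ ∈ t, (∫ x, (Lagrange.basis t id θ).eval x ∂ν) • (Measure.dirac θ).toSignedMeasure

theorem natDegree_nodeInterp_le (t : Finset ℝ) (f : ℝ → ℝ) {s : ℕ} (h : t.card ≤ s + 1) :
    (nodeInterp t f).natDegree ≤ s := by
  have h1 := Lagrange.degree_interpolate_lt (s := t) (v := id) f Function.injective_id.injOn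
  have h2 : (nodeInterp t f).degree < ((s + 1 : ℕ) : WithBot ℕ) :=
    lt_of_lt_of_le h1 (by exact_mod_cast h)
  rw [natDegree_le_iff_coeff_eq_zero]
  intro N hN
  exact coeff_eq_zero_of_degree_lt (lt_of_lt_of_le h2 (by exact_mod_cast hN))

/-- `∘ = i`: interpolation at the zeros of the degree `s + 1` orthogonal polynomial of a fixed
probability measure `μ`. -/
def interp (μ : Measure ℝ) (s : ℕ) : PolyApprox s where
  toPoly _ f := nodeInterp (orthNodes μ (s + 1)) f
  natDegree_le _ f := natDegree_nodeInterp_le _ f (card_orthNodes_le μ (s + 1))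

/-- The signed measure `[Ψ]_s` of quadrature by interpolation. -/
def interpMeasure (μ : Measure ℝ) (s : ℕ) (ν : Measure ℝ) : SignedMeasure ℝ :=
  nodeMeasure (orthNodes μ (s + 1)) ν

/-! ### Gaussian quadrature -/

open Classical in
/-- The nodes of the `k`-point Gaussian quadrature rule for `ν`: the zeros of the degree `k`
orthogonal polynomial of `ν`. If `ν` is supported on `m < k` points, the orthogonal polynomials
(that is, the Lanczos recurrence) break down at degree `m`, and the nodes are the zeros of the
degree `m` one, which are the points of the support. -/
def gaussNodes (ν : Measure ℝ) (k : ℕ) : Finset ℝ :=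
  orthNodes ν
    (Nat.findGreatest (fun j => ∀ i < j, (∫ x, (monicOrth ν i).eval x ^ 2 ∂ν) ≠ 0) k)

theorem card_gaussNodes_le (ν : Measure ℝ) (k : ℕ) : (gaussNodes ν k).card ≤ k := by
  classical
  exact (card_orthNodes_le _ _).trans (Nat.findGreatest_le k)

/-- `∘ = g`: the degree `2k - 1` Gaussian quadrature (stochastic Lanczos quadrature), that is,
interpolation at the `k` Gaussian nodes of `Ψ` itself. -/
def gauss (k : ℕ) : PolyApprox (2 * k - 1) where
  toPoly ν f := nodeInterp (gaussNodes ν k) f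
  natDegree_le ν f := natDegree_nodeInterp_le _ f ((card_gaussNodes_le ν k).trans (by omega))

/-- The Gaussian quadrature rule of degree `2k - 1` for `ν`. -/
def gaussMeasure (k : ℕ) (ν : Measure ℝ) : SignedMeasure ℝ :=
  nodeMeasure (gaussNodes ν k) ν

/-! ### Quadrature by approximation -/

/-- `∘ = a`: the projection `∑_{i ≤ s} ⟨f, p_i⟩_μ p_i` onto the orthonormal polynomials of a fixed
probability measure `μ`. -/
def approx (μ : Measure ℝ) (s : ℕ) : PolyApprox s where
  toPoly _ f := ∑ i ∈ Finset.range (s + 1),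
    C (∫ x, f x * (orthonormalPoly μ i).eval x ∂μ) * orthonormalPoly μ i
  natDegree_le _ f := by
    refine natDegree_sum_le_of_forall_le _ _ (fun i hi => ?_)
    refine (natDegree_C_mul_le _ _).trans ((natDegree_orthonormalPoly_le μ i).trans ?_)
    have := Finset.mem_range.mp hi
    omega

/-- The signed measure `[Ψ]_s` of quadrature by approximation: its density with respect to `μ` is
`∑_{i ≤ s} m_i p_i`, where `m_i = ∫ p_i dΨ` are the modified moments. -/
def approxMeasure (μ : Measure ℝ) (s : ℕ) (ν : Measure ℝ) : SignedMeasure ℝ :=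
  μ.withDensityᵥ (fun x => ∑ i ∈ Finset.range (s + 1),
    (∫ y, (orthonormalPoly μ i).eval y ∂ν) * (orthonormalPoly μ i).eval x)

/-- `μ` is a probability measure on `[a,b]` that has orthonormal polynomials of every degree up to
`s`, that is, it is not concentrated on `s` or fewer points. -/
structure IsReference (μ : Measure ℝ) (a b : ℝ) (s : ℕ) : Prop where
  isProb : IsProbabilityMeasure μ
  supported : μ (Set.Icc a b)ᶜ = 0
  nondegenerate : ∀ t : Finset ℝ, t.card ≤ s → μ (t : Set ℝ)ᶜ ≠ 0

end

end MatrixQuad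

open MatrixQuad

/-!
Invariance of the uniform measure under the rotations of each coordinate plane, applied to
`x_i x_j exp (t q)` for a diagonal quadratic form `q = ∑ i, β i * x_i ^ 2` and summed over the
planes, gives an identity between the mean and the variance of `q` under the measure tilted by
`exp (t q)`. If all `β i` lie in `[lo, hi]`, this identity becomes a differential inequality for
the cumulant generating function of `q`, and its integrated form says that `q` is sub-Gaussian
around its mean with variance proxy `(hi - lo) ^ 2 / (2 * (n + 2))`. As `∫ f dΨ_ℓ` is the value at
`v_ℓ` of such a form with mean `n⁻¹ tr f(A)`, the tail bound is Chernoff's inequality for the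
average of `nv` independent copies.

For the quadrature errors, a rule that is exact up to degree `s` has the same error for `f` and for
`f - p` whenever `deg p ≤ s`, so the error is at most the total mass of `⟨Ψ_ℓ⟩` and of the rule
times `‖f - p‖`. The weights of the Gaussian rule are nonnegative, hence its total mass is `1`.
-/

namespace MatrixQuad

noncomputable section

/-! ### Cumulant generating functions -/

theorem nonpos_of_mul_add_mul_deriv_nonpos {u u' : ℝ → ℝ} {c t : ℝ} (hc : 0 < c)
    (hu : ∀ t, HasDerivAt u (u' t) t) (hle : ∀ t, 0 < t → c * u t + t * u' t ≤ 0)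
    (ht : 0 < t) : u t ≤ 0 := by
  have hanti : AntitoneOn (fun t : ℝ => t ^ c * u t) (Set.Ici 0) := by
    refine antitoneOn_of_hasDerivWithinAt_nonpos (convex_Ici 0)
      (f' := fun t => c * t ^ (c - 1) * u t + t ^ c * u' t) ?_ ?_ ?_
    · exact ((continuous_id.rpow_const fun _ => Or.inr hc.le).mul
        (continuous_iff_continuousAt.mpr fun t => (hu t).continuousAt)).continuousOn
    · intro x hx
      rw [interior_Ici] at hx
      exact ((Real.hasDerivAt_rpow_const (Or.inl (ne_of_gt hx))).mul (hu x)).hasDerivWithinAt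
    · intro x hx
      rw [interior_Ici] at hx
      have hx0 : (0 : ℝ) < x := hx
      calc c * x ^ (c - 1) * u x + x ^ c * u' x
          = x ^ (c - 1) * (c * u x + x * u' x) := by
            rw [show x ^ c = x ^ (c - 1) * x by
              rw [← Real.rpow_add_one hx0.ne', sub_add_cancel]]
            ring
        _ ≤ 0 := mul_nonpos_of_nonneg_of_nonpos (Real.rpow_nonneg hx0.le _) (hle x hx0)
  have hle_zero := hanti Set.self_mem_Ici ht.le ht.le
  simp only [Real.zero_rpow hc.ne', zero_mul] at hle_zero
  exact nonpos_of_mul_nonpos_right hle_zero (Real.rpow_pos_of_pos ht c)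

theorem le_mul_add_mul_sq_of_mul_deriv_add_mul_deriv_le {κ κ' κ'' : ℝ → ℝ} {c m K t : ℝ}
    (hc : 0 < c) (hzero : κ 0 = 0) (hκ : ∀ t, HasDerivAt κ (κ' t) t)
    (hκ' : ∀ t, HasDerivAt κ' (κ'' t) t)
    (hle : ∀ t, 0 < t → c * (κ' t - m) + t * κ'' t ≤ K * t) (ht : 0 ≤ t) :
    κ t ≤ t * m + K / (c + 1) * t ^ 2 / 2 := by
  set r := K / (c + 1)
  have hK : r * (c + 1) = K := div_mul_cancel₀ _ (by positivity)
  have hκ'_le : ∀ t, 0 < t → κ' t - m - r * t ≤ 0 := fun t =>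
    nonpos_of_mul_add_mul_deriv_nonpos (u := fun t => κ' t - m - r * t)
      (u' := fun t => κ'' t - r) hc
      (fun t => ((hκ' t).sub_const m).fun_sub (hasDerivAt_const_mul r))
      (fun t ht => by linear_combination hle t ht - t * hK)
  have hderiv : ∀ t, HasDerivAt (fun t => κ t - t * m - r * t ^ 2 / 2) (κ' t - m - r * t) t :=
    fun t => by
      convert! ((hκ t).sub (hasDerivAt_mul_const m)).sub
        (((hasDerivAt_pow 2 t).const_mul r).div_const 2) using 1
      ring
  have hanti : AntitoneOn (fun t => κ t - t * m - r * t ^ 2 / 2) (Set.Ici 0) := by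
    refine antitoneOn_of_hasDerivWithinAt_nonpos (convex_Ici 0)
      (fun t _ => (hderiv t).continuousAt.continuousWithinAt)
      (fun t _ => (hderiv t).hasDerivWithinAt) fun t ht => hκ'_le t ?_
    rwa [interior_Ici] at ht
  have hle_zero := hanti Set.self_mem_Ici ht ht
  simp only [hzero] at hle_zero
  linarith

theorem cgf_le_of_mul_integral_tilted_add_mul_variance_tilted_le {Ω : Type*} [MeasurableSpace Ω]
    {μ : Measure Ω} [IsProbabilityMeasure μ] {X : Ω → ℝ} {c m K t : ℝ}
    (hX : ∀ t, Integrable (fun ω => Real.exp (t * X ω)) μ) (hc : 0 < c)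
    (hle : ∀ t, 0 < t →
      c * (∫ ω, X ω ∂μ.tilted (t * X ·) - m) + t * Var[X; μ.tilted (t * X ·)] ≤ K * t)
    (ht : 0 ≤ t) : cgf X μ t ≤ t * m + K / (c + 1) * t ^ 2 / 2 := by
  have hmem : ∀ t, t ∈ interior (integrableExpSet X μ) := fun t => by
    simp [show integrableExpSet X μ = Set.univ from Set.eq_univ_of_forall hX]
  refine le_mul_add_mul_sq_of_mul_deriv_add_mul_deriv_le (κ := cgf X μ) (κ' := deriv (cgf X μ))
    (κ'' := iteratedDeriv 2 (cgf X μ)) hc cgf_zero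
    (fun t => (analyticAt_cgf (hmem t)).differentiableAt.hasDerivAt) (fun t => ?_)
    (fun t ht => ?_) ht
  · rw [iteratedDeriv_succ, iteratedDeriv_one]
    exact (analyticAt_cgf (hmem t)).deriv.differentiableAt.hasDerivAt
  · rw [← integral_tilted_mul_self (hmem t), ← variance_tilted_mul (hmem t)]
    exact hle t ht

theorem hasSubgaussianMGF_sub_const_of_cgf_le {Ω : Type*} [MeasurableSpace Ω] {μ : Measure Ω}
    [NeZero μ] {X : Ω → ℝ} {c : NNReal} {m : ℝ}
    (hX : ∀ t, Integrable (fun ω => Real.exp (t * X ω)) μ)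
    (hle : ∀ t, cgf X μ t ≤ t * m + c * t ^ 2 / 2) :
    HasSubgaussianMGF (fun ω => X ω - m) c μ := by
  refine ⟨fun t => ?_, fun t => ?_⟩
  · simp_rw [mul_sub, Real.exp_sub]
    exact (hX t).div_const _
  · simp_rw [sub_eq_add_neg, mgf_add_const, ← exp_cgf (hX t), ← Real.exp_add]
    exact Real.exp_le_exp.mpr (by linarith [hle t])

/-! ### Measures on the sphere that are invariant under isometries -/

theorem integral_deriv_eq_zero_of_integral_const {S : Type*} [TopologicalSpace S] [CompactSpace S]
    [MeasurableSpace S] [OpensMeasurableSpace S] {μ : Measure S} [IsFiniteMeasure μ]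
    {G G' : ℝ → S → ℝ} {C : ℝ} (hG : Continuous fun p : ℝ × S => G p.1 p.2)
    (hG' : Continuous fun p : ℝ × S => G' p.1 p.2)
    (hderiv : ∀ θ v, HasDerivAt (fun θ => G θ v) (G' θ v) θ)
    (hconst : ∀ θ, ∫ v, G θ v ∂μ = C) : ∫ v, G' 0 v ∂μ = 0 := by
  obtain ⟨M, hM⟩ := ((isCompact_Icc (a := (-1 : ℝ)) (b := 1)).prod
    (isCompact_univ (X := S))).exists_bound_of_continuousOn hG'.continuousOn
  have hGθ : ∀ θ, Continuous (G θ) := fun θ => hG.comp (Continuous.prodMk_right θ)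
  have hderiv_integral := (hasDerivAt_integral_of_dominated_loc_of_deriv_le (μ := μ) (F := G)
    (F' := G') (x₀ := 0) (s := Set.Icc (-1) 1) (bound := fun _ => M)
    (Icc_mem_nhds (by norm_num) (by norm_num))
    (.of_forall fun θ => (hGθ θ).aestronglyMeasurable)
    ((hGθ 0).integrable_of_hasCompactSupport (HasCompactSupport.of_compactSpace _))
    (hG'.comp (Continuous.prodMk_right 0)).aestronglyMeasurable
    (.of_forall fun v θ hθ => hM (θ, v) ⟨hθ, Set.mem_univ v⟩) (integrable_const M)
    (.of_forall fun v θ _ => hderiv θ v)).2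
  simp_rw [hconst] at hderiv_integral
  exact hderiv_integral.unique (hasDerivAt_const _ _)

section Sphere

variable {E : Type*} [NormedAddCommGroup E] [InnerProductSpace ℝ E]

/-- The action of a linear isometry on the unit sphere. -/
def sphereMap (e : E ≃ₗᵢ[ℝ] E) (v : Metric.sphere (0 : E) 1) : Metric.sphere (0 : E) 1 :=
  ⟨e v, by simp⟩

theorem continuous_sphereMap (e : E ≃ₗᵢ[ℝ] E) : Continuous (sphereMap e) :=
  (e.continuous.comp continuous_subtype_val).subtype_mk _

variable [MeasurableSpace E]

/-- Invariance of a measure on the unit sphere under all linear isometries of the ambient space,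
the only property of the uniform measure that enters the concentration argument. -/
def IsIsometryInvariant (σ : Measure (Metric.sphere (0 : E) 1)) : Prop :=
  ∀ e : E ≃ₗᵢ[ℝ] E, MeasurePreserving (sphereMap e) σ σ

variable [FiniteDimensional ℝ E] [BorelSpace E]

open scoped Pointwise in
theorem isIsometryInvariant_toSphere : IsIsometryInvariant (volume : Measure E).toSphere := by
  refine fun e => ⟨(continuous_sphereMap e).measurable, Measure.ext fun s hs => ?_⟩
  have hcone : (Set.Ioo (0 : ℝ) 1 • (Subtype.val '' (sphereMap e ⁻¹' s)) : Set E) =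
      e ⁻¹' (Set.Ioo (0 : ℝ) 1 • (Subtype.val '' s)) := by
    ext x
    simp only [Set.mem_smul, Set.mem_image, Set.mem_preimage]
    constructor
    · rintro ⟨r, hr, _, ⟨v, hv, rfl⟩, rfl⟩
      exact ⟨r, hr, _, ⟨_, hv, rfl⟩, by simp [sphereMap]⟩
    · rintro ⟨r, hr, _, ⟨v, hv, rfl⟩, hx⟩
      exact ⟨r, hr, _, ⟨sphereMap e.symm v, by simpa [sphereMap] using hv, rfl⟩,
        e.injective (by simp [sphereMap, hx])⟩
  rw [Measure.map_apply (continuous_sphereMap e).measurable hs,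
    Measure.toSphere_apply' _ ((continuous_sphereMap e).measurable hs),
    Measure.toSphere_apply' _ hs, hcone,
    e.measurePreserving.measure_preimage_emb e.toHomeomorph.measurableEmbedding]

theorem integrable_sphere_of_continuous {σ : Measure (Metric.sphere (0 : E) 1)} [IsFiniteMeasure σ]
    {F : Metric.sphere (0 : E) 1 → ℝ} (hF : Continuous F) : Integrable F σ :=
  hF.integrable_of_hasCompactSupport (HasCompactSupport.of_compactSpace _)

omit [FiniteDimensional ℝ E] in
theorem integral_comp_of_isIsometryInvariant {σ : Measure (Metric.sphere (0 : E) 1)}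
    (hσ : IsIsometryInvariant σ) (e : E ≃ₗᵢ[ℝ] E) {F : E → ℝ} (hF : Continuous F) :
    ∫ v, F (e v) ∂σ = ∫ v, F v ∂σ := by
  conv_rhs => rw [← (hσ e).map_eq]
  exact (integral_map (hσ e).measurable.aemeasurable
    (hF.comp continuous_subtype_val).aestronglyMeasurable).symm

theorem integral_fderiv_skewAdjoint_eq_zero {σ : Measure (Metric.sphere (0 : E) 1)}
    [IsFiniteMeasure σ] (hσ : IsIsometryInvariant σ) {J : E →L[ℝ] E}
    (hJ : J ∈ skewAdjoint (E →L[ℝ] E)) {F : E → ℝ} (hF : ContDiff ℝ 1 F) :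
    ∫ v, fderiv ℝ F v (J v) ∂σ = 0 := by
  let := NormedAlgebra.restrictScalars ℚ ℝ (E →L[ℝ] E)
  let flow : ℝ → E →L[ℝ] E := fun θ => NormedSpace.exp (θ • J)
  have hflow : ∀ θ, HasDerivAt flow (flow θ * J) θ := hasDerivAt_exp_smul_const J
  have : Continuous flow :=
    continuous_iff_continuousAt.mpr fun θ => (hflow θ).continuousAt
  have := hF.continuous_fderiv one_ne_zero
  have hderiv : ∀ θ (v : Metric.sphere (0 : E) 1),
      HasDerivAt (fun θ => F (flow θ v)) (fderiv ℝ F (flow θ v) (flow θ (J v))) θ := fun θ v =>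
    ((hF.differentiable one_ne_zero).differentiableAt.hasFDerivAt).comp_hasDerivAt θ
      (((ContinuousLinearMap.apply ℝ E (v : E)).hasFDerivAt).comp_hasDerivAt θ (hflow θ))
  have hconst : ∀ θ, ∫ v : Metric.sphere (0 : E) 1, F (flow θ v) ∂σ = ∫ v, F v ∂σ := fun θ =>
    integral_comp_of_isIsometryInvariant hσ (Unitary.linearIsometryEquiv
      ⟨flow θ, NormedSpace.exp_mem_unitary_of_mem_skewAdjoint
        (skewAdjoint.smul_mem θ hJ)⟩) hF.continuous
  have hderiv_zero := integral_deriv_eq_zero_of_integral_const (μ := σ)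
    (G := fun θ v => F (flow θ v)) (G' := fun θ v => fderiv ℝ F (flow θ v) (flow θ (J v)))
    (hF.continuous.comp (by fun_prop)) (by fun_prop) hderiv hconst
  simpa [flow] using hderiv_zero

theorem integral_fderiv_mul_exp_eq_zero {σ : Measure (Metric.sphere (0 : E) 1)}
    [IsFiniteMeasure σ] (hσ : IsIsometryInvariant σ) {J : E →L[ℝ] E}
    (hJ : J ∈ skewAdjoint (E →L[ℝ] E)) {G q : E → ℝ} (hG : ContDiff ℝ 1 G) (hq : ContDiff ℝ 1 q) :
    ∫ v, (fderiv ℝ G v (J v) + G v * fderiv ℝ q v (J v)) * Real.exp (q v) ∂σ = 0 := by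
  rw [← integral_fderiv_skewAdjoint_eq_zero hσ hJ (hG.mul hq.exp)]
  refine integral_congr_ae (.of_forall fun v => ?_)
  have hGv := (hG.differentiable one_ne_zero v).hasFDerivAt
  have hqv := (hq.differentiable one_ne_zero v).hasFDerivAt
  simp only [(hGv.fun_mul hqv.exp).fderiv, add_apply, smul_apply, smul_eq_mul]
  ring

/-- The generator of the rotations of the plane spanned by two orthonormal vectors. -/
def planeGenerator (u w : E) : E →L[ℝ] E :=
  InnerProductSpace.rankOne ℝ w u - InnerProductSpace.rankOne ℝ u w

omit [MeasurableSpace E] [BorelSpace E] in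
theorem planeGenerator_mem_skewAdjoint (u w : E) :
    planeGenerator u w ∈ skewAdjoint (E →L[ℝ] E) := by
  simp [planeGenerator, skewAdjoint.mem_iff, ContinuousLinearMap.star_eq_adjoint]

end Sphere

/-! ### Quadratic forms on the sphere -/

section DiagForm

open scoped RealInnerProductSpace

variable {ι E : Type*} [Fintype ι] [NormedAddCommGroup E] [InnerProductSpace ℝ E]
  (b : OrthonormalBasis ι ℝ E) (β : ι → ℝ)

/-- The quadratic form with eigenvectors `b i` and eigenvalues `β i`. -/
def diagForm (v : E) : ℝ := ∑ i, β i * ⟪b i, v⟫ ^ 2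

@[fun_prop]
theorem contDiff_diagForm : ContDiff ℝ 1 (diagForm b β) :=
  ContDiff.sum fun _ _ => contDiff_const.mul ((contDiff_const.inner ℝ contDiff_id).pow 2)

@[fun_prop]
theorem continuous_diagForm : Continuous (diagForm b β) :=
  (contDiff_diagForm b β).continuous

theorem diagForm_neg (v : E) : diagForm b (-β) v = -diagForm b β v := by
  simp [diagForm]

theorem diagForm_basis (i : ι) : diagForm b β (b i) = β i := by
  classical
  simp [diagForm, b.inner_eq_ite]

theorem sum_inner_sq_eq_one (v : Metric.sphere (0 : E) 1) : ∑ i, ⟪b i, (v : E)⟫ ^ 2 = 1 := by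
  simpa using b.sum_sq_norm_inner_right (v : E)

theorem sum_diagForm_basis {κ : Type*} [Fintype κ] (e : OrthonormalBasis κ ℝ E) :
    ∑ j, diagForm b β (e j) = ∑ i, β i := by
  simp only [diagForm]
  rw [Finset.sum_comm]
  refine Finset.sum_congr rfl fun i _ => ?_
  have hparseval := e.sum_sq_norm_inner_left (b i)
  simp only [Real.norm_eq_abs, sq_abs, b.norm_eq_one, one_pow] at hparseval
  rw [← Finset.mul_sum, hparseval, mul_one]

theorem exists_diagForm_eq_sum_mul_inner_sq [FiniteDimensional ℝ E] {n : ℕ}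
    (hn : Module.finrank ℝ E = n) {κ : Type*} [Fintype κ] (c : κ → ℝ) (w : κ → E) :
    ∃ (b : OrthonormalBasis (Fin n) ℝ E) (β : Fin n → ℝ),
      ∀ v, ∑ k, c k * ⟪w k, v⟫ ^ 2 = diagForm b β v := by
  let T : E →ₗ[ℝ] E := ∑ k, c k • (InnerProductSpace.rankOne ℝ (w k) (w k)).toLinearMap
  have hTv : ∀ x y, ⟪x, T y⟫ = ∑ k, c k * (⟪w k, x⟫ * ⟪w k, y⟫) := fun x y => by
    simp only [T, LinearMap.sum_apply, LinearMap.smul_apply, ContinuousLinearMap.coe_coe,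
      InnerProductSpace.rankOne_apply, inner_sum, real_inner_smul_right, real_inner_comm x]
    exact Finset.sum_congr rfl fun k _ => by ring
  have hT : T.IsSymmetric := fun x y => by
    rw [real_inner_comm, hTv, hTv]
    simp only [mul_comm ⟪w _, x⟫]
  refine ⟨hT.eigenvectorBasis hn, hT.eigenvalues hn, fun v => ?_⟩
  calc ∑ k, c k * ⟪w k, v⟫ ^ 2 = ⟪v, T v⟫ := by simp only [hTv, sq]
    _ = ∑ i, ⟪v, hT.eigenvectorBasis hn i⟫ * ⟪hT.eigenvectorBasis hn i, T v⟫ :=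
        ((hT.eigenvectorBasis hn).sum_inner_mul_inner v (T v)).symm
    _ = diagForm (hT.eigenvectorBasis hn) (hT.eigenvalues hn) v := by
        refine Finset.sum_congr rfl fun i _ => ?_
        rw [← hT, hT.apply_eigenvectorBasis, RCLike.ofReal_real_eq_id, id_eq,
          real_inner_smul_left, real_inner_comm v]
        ring

theorem fderiv_diagForm (v w : E) :
    fderiv ℝ (diagForm b β) v w = 2 * ∑ i, β i * (⟪b i, v⟫ * ⟪b i, w⟫) := by
  have hderiv : HasFDerivAt (diagForm b β)
      (∑ i, β i • ((2 : ℕ) • ⟪b i, v⟫ ^ (2 - 1)) • innerSL ℝ (b i)) v :=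
    HasFDerivAt.fun_sum fun _ _ => (((innerSL ℝ (b _)).hasFDerivAt).pow 2).const_mul _
  simp only [hderiv.fderiv, sum_apply, smul_apply, Finset.mul_sum, Nat.add_one_sub_one, pow_one,
    nsmul_eq_mul, Nat.cast_ofNat, innerSL_apply_apply, smul_eq_mul]
  exact Finset.sum_congr rfl fun i _ => by ring

theorem sum_sq_mul_inner_sq_le {lo hi : ℝ} (hβ : ∀ i, β i ∈ Set.Icc lo hi)
    (v : Metric.sphere (0 : E) 1) :
    ∑ i, β i ^ 2 * ⟪b i, (v : E)⟫ ^ 2 ≤ (lo + hi) * diagForm b β v - lo * hi := by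
  have hnonneg : 0 ≤ ∑ i, (hi - β i) * (β i - lo) * ⟪b i, (v : E)⟫ ^ 2 :=
    Finset.sum_nonneg fun i _ => mul_nonneg (mul_nonneg (sub_nonneg.mpr (hβ i).2)
      (sub_nonneg.mpr (hβ i).1)) (sq_nonneg _)
  have hexpand : ∑ i, (hi - β i) * (β i - lo) * ⟪b i, (v : E)⟫ ^ 2 =
      (lo + hi) * diagForm b β v - lo * hi * ∑ i, ⟪b i, (v : E)⟫ ^ 2
        - ∑ i, β i ^ 2 * ⟪b i, (v : E)⟫ ^ 2 := by
    simp only [diagForm, Finset.mul_sum, ← Finset.sum_sub_distrib]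
    exact Finset.sum_congr rfl fun i _ => by ring
  rw [hexpand, sum_inner_sq_eq_one] at hnonneg
  linarith

theorem sum_sum_sub_mul_eq {x : ι → ℝ} (hx : ∑ i, x i ^ 2 = 1) (t : ℝ) :
    ∑ i, ∑ j, (β j - β i) * (x i ^ 2 - x j ^ 2 + 2 * t * (β j - β i) * (x i * x j) ^ 2) =
      2 * (∑ i, β i - Fintype.card ι * ∑ i, β i * x i ^ 2
        + 2 * t * (∑ i, β i ^ 2 * x i ^ 2 - (∑ i, β i * x i ^ 2) ^ 2)) := by
  have hterm : ∀ i j,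
      (β j - β i) * (x i ^ 2 - x j ^ 2 + 2 * t * (β j - β i) * (x i * x j) ^ 2) =
      x i ^ 2 * β j - 1 * (β j * x j ^ 2) - β i * x i ^ 2 + β i * x j ^ 2
        + 2 * t * (x i ^ 2 * (β j ^ 2 * x j ^ 2) - 2 * ((β i * x i ^ 2) * (β j * x j ^ 2))
          + (β i ^ 2 * x i ^ 2) * x j ^ 2) := fun i j => by ring
  simp only [hterm, Finset.sum_add_distrib, Finset.sum_sub_distrib, ← Finset.mul_sum,
    ← Finset.sum_mul, hx, Finset.sum_const, Finset.card_univ, nsmul_eq_mul]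
  simp_rw [mul_left_comm (β _) (Fintype.card ι : ℝ), ← Finset.mul_sum]
  ring

theorem inner_planeGenerator [DecidableEq ι] (i j k : ι) (v : E) :
    ⟪b k, planeGenerator (b i) (b j) v⟫ =
      (if k = j then ⟪b i, v⟫ else 0) - if k = i then ⟪b j, v⟫ else 0 := by
  simp [planeGenerator, inner_sub_right, real_inner_smul_right, b.inner_eq_ite]

theorem fderiv_diagForm_planeGenerator (i j : ι) (v : E) :
    fderiv ℝ (diagForm b β) v (planeGenerator (b i) (b j) v) =
      2 * (β j - β i) * (⟪b i, v⟫ * ⟪b j, v⟫) := by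
  classical
  simp only [fderiv_diagForm, inner_planeGenerator, mul_sub, mul_ite, mul_zero,
    Finset.sum_sub_distrib, Finset.sum_ite_eq', Finset.mem_univ, if_true]
  ring

theorem fderiv_inner_mul_inner_planeGenerator {i j : ι} (hij : i ≠ j) (v : E) :
    fderiv ℝ (fun v => ⟪b i, v⟫ * ⟪b j, v⟫) v (planeGenerator (b i) (b j) v) =
      ⟪b i, v⟫ ^ 2 - ⟪b j, v⟫ ^ 2 := by
  classical
  have hderiv : HasFDerivAt (fun v => ⟪b i, v⟫ * ⟪b j, v⟫)
      (⟪b i, v⟫ • innerSL ℝ (b j) + ⟪b j, v⟫ • innerSL ℝ (b i)) v :=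
    (innerSL ℝ (b i)).hasFDerivAt.mul (innerSL ℝ (b j)).hasFDerivAt
  simp only [hderiv.fderiv, add_apply, smul_apply, innerSL_apply_apply, inner_planeGenerator,
    hij, hij.symm, if_true, if_false, smul_eq_mul]
  ring

variable [MeasurableSpace E] [BorelSpace E] {σ : Measure (Metric.sphere (0 : E) 1)}

/-- Invariance under the rotations of the plane of `b i` and `b j`, applied to the function
`⟪b i, v⟫ * ⟪b j, v⟫ * exp (t * diagForm b β v)`. -/
theorem integral_plane_identity [FiniteDimensional ℝ E] [IsFiniteMeasure σ]
    (hσ : IsIsometryInvariant σ) (t : ℝ) (i j : ι) :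
    ∫ v : Metric.sphere (0 : E) 1,
      (β j - β i) * (⟪b i, (v : E)⟫ ^ 2 - ⟪b j, (v : E)⟫ ^ 2
        + 2 * t * (β j - β i) * (⟪b i, (v : E)⟫ * ⟪b j, (v : E)⟫) ^ 2)
        * Real.exp (t * diagForm b β v) ∂σ = 0 := by
  rcases eq_or_ne i j with rfl | hij
  · simp
  have hzero := integral_fderiv_mul_exp_eq_zero hσ (planeGenerator_mem_skewAdjoint (b i) (b j))
    (G := fun v => ⟪b i, v⟫ * ⟪b j, v⟫) (q := fun v => t * diagForm b β v)
    ((contDiff_const.inner ℝ contDiff_id).mul (contDiff_const.inner ℝ contDiff_id)) (by fun_prop)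
  simp_rw [fderiv_inner_mul_inner_planeGenerator b hij, fderiv_const_mul
    ((contDiff_diagForm b β).differentiable one_ne_zero _), smul_apply,
    fderiv_diagForm_planeGenerator] at hzero
  simp_rw [mul_assoc (β j - β i), integral_const_mul]
  refine mul_eq_zero_of_right _ (hzero ▸ integral_congr_ae (.of_forall fun v => ?_))
  simp only [smul_eq_mul]
  ring

theorem integral_sphere_identity [FiniteDimensional ℝ E] [IsFiniteMeasure σ]
    (hσ : IsIsometryInvariant σ) (t : ℝ) :
    ∫ v : Metric.sphere (0 : E) 1,
      (∑ i, β i - Fintype.card ι * diagForm b β v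
        + 2 * t * (∑ i, β i ^ 2 * ⟪b i, (v : E)⟫ ^ 2 - diagForm b β v ^ 2))
        * Real.exp (t * diagForm b β v) ∂σ = 0 := by
  have hsum : ∑ i, ∑ j, ∫ v : Metric.sphere (0 : E) 1,
      (β j - β i) * (⟪b i, (v : E)⟫ ^ 2 - ⟪b j, (v : E)⟫ ^ 2
        + 2 * t * (β j - β i) * (⟪b i, (v : E)⟫ * ⟪b j, (v : E)⟫) ^ 2)
        * Real.exp (t * diagForm b β v) ∂σ = 0 :=
    Finset.sum_eq_zero fun i _ => Finset.sum_eq_zero fun j _ => integral_plane_identity b β hσ t i j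
  have hint : ∀ i j, Integrable (fun v : Metric.sphere (0 : E) 1 =>
      (β j - β i) * (⟪b i, (v : E)⟫ ^ 2 - ⟪b j, (v : E)⟫ ^ 2
        + 2 * t * (β j - β i) * (⟪b i, (v : E)⟫ * ⟪b j, (v : E)⟫) ^ 2)
        * Real.exp (t * diagForm b β v)) σ := fun i j =>
    integrable_sphere_of_continuous (by fun_prop)
  simp_rw [← integral_finsetSum _ fun j _ => hint _ j] at hsum
  rw [← integral_finsetSum _ fun i _ => integrable_finsetSum _ fun j _ => hint i j] at hsum
  simp_rw [← Finset.sum_mul, sum_sum_sub_mul_eq β (sum_inner_sq_eq_one b _), mul_assoc (2 : ℝ) _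
    (Real.exp _), integral_const_mul] at hsum
  simpa [diagForm] using hsum

/-- The quadratic `(hi - β) * (β - lo)` bounds `∑ i, β i ^ 2 * x i ^ 2` by a linear function of the
form `q`, so that the identity only involves the mean and the variance of `q`. -/
theorem card_mul_integral_tilted_add_mul_variance_tilted_le [FiniteDimensional ℝ E]
    [IsProbabilityMeasure σ] (hσ : IsIsometryInvariant σ) {lo hi : ℝ}
    (hβ : ∀ i, β i ∈ Set.Icc lo hi) {t : ℝ} (ht : 0 ≤ t) :
    Fintype.card ι * ∫ v : Metric.sphere (0 : E) 1, diagForm b β v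
        ∂σ.tilted (fun v => t * diagForm b β v) - ∑ i, β i
      + 2 * t * Var[fun v : Metric.sphere (0 : E) 1 => diagForm b β v;
          σ.tilted (fun v => t * diagForm b β v)] ≤ (hi - lo) ^ 2 / 2 * t := by
  set τ := σ.tilted (fun v => t * diagForm b β v) with hτ
  have hτ_prob : IsProbabilityMeasure τ :=
    isProbabilityMeasure_tilted (integrable_sphere_of_continuous (by fun_prop))
  have hint : ∀ F : Metric.sphere (0 : E) 1 → ℝ, Continuous F → Integrable F τ := fun F hF =>
    integrable_sphere_of_continuous hF
  set m := ∫ v : Metric.sphere (0 : E) 1, diagForm b β v ∂τ with hm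
  have hid : ∫ v : Metric.sphere (0 : E) 1, (∑ i, β i - Fintype.card ι * diagForm b β v
      + 2 * t * (∑ i, β i ^ 2 * ⟪b i, (v : E)⟫ ^ 2 - diagForm b β v ^ 2)) ∂τ = 0 := by
    simp_rw [hτ, integral_tilted, smul_eq_mul, div_mul_eq_mul_div, integral_div,
      mul_comm (Real.exp _)]
    rw [integral_sphere_identity b β hσ t, zero_div]
  have hle : ∫ v : Metric.sphere (0 : E) 1, (∑ i, β i - Fintype.card ι * diagForm b β v
      + 2 * t * (∑ i, β i ^ 2 * ⟪b i, (v : E)⟫ ^ 2 - diagForm b β v ^ 2)) ∂τ ≤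
      ∫ v : Metric.sphere (0 : E) 1, (∑ i, β i - 2 * t * (lo * hi)
        + (2 * t * (lo + hi) - Fintype.card ι) * diagForm b β v
        - 2 * t * diagForm b β v ^ 2) ∂τ := by
    refine integral_mono (hint _ (by fun_prop)) (hint _ (by fun_prop)) fun v => ?_
    have := mul_le_mul_of_nonneg_left (sum_sq_mul_inner_sq_le b β hβ v)
      (by positivity : 0 ≤ 2 * t)
    simp only
    linarith
  rw [hid, integral_sub (hint _ (by fun_prop)) (hint _ (by fun_prop)),
    integral_add (hint _ (by fun_prop)) (hint _ (by fun_prop)), integral_const_mul,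
    integral_const_mul, integral_const, probReal_univ, one_smul, ← hm] at hle
  have hvar : Var[fun v : Metric.sphere (0 : E) 1 => diagForm b β v; τ] =
      ∫ v : Metric.sphere (0 : E) 1, diagForm b β v ^ 2 ∂τ - m ^ 2 :=
    variance_eq_sub ((memLp_two_iff_integrable_sq
      (hint _ (by fun_prop)).aestronglyMeasurable).mpr (hint _ (by fun_prop)))
  rw [hvar]
  nlinarith [mul_nonneg ht (sq_nonneg (m - (lo + hi) / 2))]

theorem cgf_diagForm_le [FiniteDimensional ℝ E] [Nonempty ι] [IsProbabilityMeasure σ]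
    (hσ : IsIsometryInvariant σ) {lo hi : ℝ} (hβ : ∀ i, β i ∈ Set.Icc lo hi) {t : ℝ} (ht : 0 ≤ t) :
    cgf (fun v : Metric.sphere (0 : E) 1 => diagForm b β v) σ t ≤
      t * ((Fintype.card ι : ℝ)⁻¹ * ∑ i, β i)
        + (hi - lo) ^ 2 / (2 * (Fintype.card ι + 2)) * t ^ 2 / 2 := by
  have hcard : (0 : ℝ) < Fintype.card ι := by exact_mod_cast Fintype.card_pos
  have hle := cgf_le_of_mul_integral_tilted_add_mul_variance_tilted_le (μ := σ)
    (X := fun v : Metric.sphere (0 : E) 1 => diagForm b β v) (c := Fintype.card ι / 2)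
    (m := (Fintype.card ι : ℝ)⁻¹ * ∑ i, β i) (K := (hi - lo) ^ 2 / 4)
    (fun t => integrable_sphere_of_continuous (by fun_prop)) (by positivity)
    (fun t ht => by
      linarith [card_mul_integral_tilted_add_mul_variance_tilted_le b β hσ hβ ht.le,
        mul_inv_cancel_left₀ hcard.ne' (∑ i, β i)]) ht
  refine hle.trans_eq ?_
  field_simp
  ring

theorem hasSubgaussianMGF_diagForm [FiniteDimensional ℝ E] [Nonempty ι] [IsProbabilityMeasure σ]
    (hσ : IsIsometryInvariant σ) {lo hi : ℝ} (hβ : ∀ i, β i ∈ Set.Icc lo hi) :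
    HasSubgaussianMGF (fun v : Metric.sphere (0 : E) 1 =>
        diagForm b β v - (Fintype.card ι : ℝ)⁻¹ * ∑ i, β i)
      (Real.toNNReal ((hi - lo) ^ 2 / (2 * (Fintype.card ι + 2)))) σ := by
  refine hasSubgaussianMGF_sub_const_of_cgf_le
    (fun t => integrable_sphere_of_continuous (by fun_prop)) fun t => ?_
  rw [Real.coe_toNNReal _ (by positivity)]
  rcases le_total 0 t with ht | ht
  · exact cgf_diagForm_le b β hσ hβ ht
  · have hle_neg := cgf_diagForm_le b (-β) hσ (lo := -hi) (hi := -lo)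
      (fun i => ⟨neg_le_neg (hβ i).2, neg_le_neg (hβ i).1⟩) (neg_nonneg.mpr ht)
    simp_rw [diagForm_neg, Pi.neg_apply, Finset.sum_neg_distrib, mul_neg, neg_mul, neg_neg,
      neg_sq, neg_sub_neg] at hle_neg
    rwa [← Pi.neg_def, cgf_neg, neg_neg] at hle_neg

end DiagForm

/-! ### Averages of independent sub-Gaussian variables -/

theorem measureReal_le_abs_average_le {ι Ω : Type*} [Fintype ι] [Nonempty ι] [MeasurableSpace Ω]
    {P : Measure Ω} {X : ι → Ω → ℝ} {c : NNReal} (hindep : iIndepFun X P)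
    (hX : ∀ i, HasSubgaussianMGF (X i) c P) {ε : ℝ} (hε : 0 ≤ ε) :
    P.real {ω | ε ≤ |(Fintype.card ι : ℝ)⁻¹ * ∑ i, X i ω|} ≤
      2 * Real.exp (-(Fintype.card ι * ε ^ 2 / (2 * c))) := by
  have := hindep.isProbabilityMeasure
  have hcard : (0 : ℝ) < Fintype.card ι := by exact_mod_cast Fintype.card_pos
  have hexp : -(Fintype.card ι * ε) ^ 2 / (2 * ((∑ _i : ι, c : NNReal) : ℝ)) =
      -(Fintype.card ι * ε ^ 2 / (2 * c)) := by
    simp only [Finset.sum_const, Finset.card_univ, nsmul_eq_mul, NNReal.coe_mul, NNReal.coe_natCast]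
    field_simp
  have hupper := HasSubgaussianMGF.measure_sum_ge_le_of_iIndepFun hindep (s := Finset.univ)
    (fun i _ => hX i) (ε := Fintype.card ι * ε) (by positivity)
  have hlower := HasSubgaussianMGF.measure_sum_ge_le_of_iIndepFun
    (hindep.comp (fun _ x => -x) fun _ => measurable_neg) (s := Finset.univ)
    (fun i _ => (hX i).neg) (ε := Fintype.card ι * ε) (by positivity)
  rw [hexp] at hupper hlower
  calc P.real {ω | ε ≤ |(Fintype.card ι : ℝ)⁻¹ * ∑ i, X i ω|}
      ≤ P.real ({ω | Fintype.card ι * ε ≤ ∑ i, X i ω} ∪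
          {ω | Fintype.card ι * ε ≤ ∑ i, -X i ω}) := by
        refine measureReal_mono (fun ω hω => ?_)
        rw [Set.mem_ofPred_eq, abs_mul, abs_inv, Nat.abs_cast, inv_mul_eq_div, le_div_iff₀' hcard,
          le_abs, ← Finset.sum_neg_distrib] at hω
        exact hω
    _ ≤ _ := measureReal_union_le _ _
    _ ≤ 2 * Real.exp (-(Fintype.card ι * ε ^ 2 / (2 * c))) :=
        (add_le_add hupper hlower).trans_eq (two_mul _).symm

/-! ### Spectral measures -/

theorem isIsometryInvariant_unifSphere (n : ℕ) : IsIsometryInvariant (unifSphere n) :=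
  fun e => (isIsometryInvariant_toSphere e).smul_measure _

theorem isProbabilityMeasure_unifSphere {n : ℕ} (hn : 0 < n) :
    IsProbabilityMeasure (unifSphere n) := by
  have : Nonempty (Fin n) := ⟨⟨0, hn⟩⟩
  refine ⟨ENNReal.inv_mul_cancel ?_ (measure_ne_top _ _)⟩
  exact Measure.measure_univ_eq_zero.not.mpr (Measure.toSphere_ne_zero _)

theorem norm_inner_toComplex_sq {n : ℕ} (v : EuclideanSpace ℝ (Fin n))
    (u : EuclideanSpace ℂ (Fin n)) :
    ‖inner ℂ (toComplex v) u‖ ^ 2 = inner ℝ (WithLp.toLp 2 fun j => (u j).re) v ^ 2 +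
      inner ℝ (WithLp.toLp 2 fun j => (u j).im) v ^ 2 := by
  rw [Complex.sq_norm, Complex.normSq_apply, ← sq, ← sq]
  simp [PiLp.inner_apply, toComplex, mul_comm]

section WeightedCESM

variable {n : ℕ} {A : Matrix (Fin n) (Fin n) ℂ} (hA : A.IsHermitian)

theorem integrable_weightedCESM (v : EuclideanSpace ℝ (Fin n)) (g : ℝ → ℝ) :
    Integrable g (weightedCESM hA v) :=
  integrable_finsetSum_measure.mpr fun _ _ =>
    (integrable_dirac (by simp)).smul_measure ENNReal.ofReal_ne_top

theorem integral_weightedCESM (v : EuclideanSpace ℝ (Fin n)) (g : ℝ → ℝ) :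
    ∫ x, g x ∂weightedCESM hA v =
      ∑ i, ‖inner ℂ (toComplex v) (hA.eigenvectorBasis i)‖ ^ 2 * g (hA.eigenvalues i) := by
  rw [weightedCESM, integral_finsetSum_measure fun _ _ =>
    (integrable_dirac (by simp)).smul_measure ENNReal.ofReal_ne_top]
  simp

theorem isProbabilityMeasure_weightedCESM {v : EuclideanSpace ℝ (Fin n)} (hv : ‖v‖ = 1) :
    IsProbabilityMeasure (weightedCESM hA v) := by
  have hnorm : ‖toComplex v‖ = ‖v‖ := by simp [toComplex, EuclideanSpace.norm_eq]
  refine ⟨?_⟩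
  simp only [weightedCESM, Measure.finsetSum_apply, Measure.smul_apply, measure_univ, smul_eq_mul,
    mul_one]
  rw [← ENNReal.ofReal_sum_of_nonneg fun _ _ => by positivity,
    hA.eigenvectorBasis.sum_sq_norm_inner_left, hnorm, hv, one_pow, ENNReal.ofReal_one]

theorem ae_weightedCESM_mem {s : Set ℝ} (hs : ∀ i, hA.eigenvalues i ∈ s)
    (v : EuclideanSpace ℝ (Fin n)) : ∀ᵐ x ∂weightedCESM hA v, x ∈ s :=
  ae_iff.mpr (by simp [weightedCESM, Measure.finsetSum_apply, hs])

theorem trace_cfc (f : ℝ → ℝ) : (hA.cfc f).trace = ((∑ i, f (hA.eigenvalues i) : ℝ) : ℂ) := by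
  rw [Matrix.IsHermitian.cfc, Unitary.conjStarAlgAut_apply, Matrix.trace_mul_cycle,
    Unitary.coe_star_mul_self, Matrix.one_mul, Matrix.trace_diagonal]
  simp

theorem sum_integral_weightedCESM_single (f : ℝ → ℝ) :
    ∑ j, ∫ x, f x ∂weightedCESM hA (EuclideanSpace.basisFun (Fin n) ℝ j) =
      ∑ i, f (hA.eigenvalues i) := by
  simp only [integral_weightedCESM]
  rw [Finset.sum_comm]
  refine Finset.sum_congr rfl fun i _ => ?_
  have htoComplex : ∀ j, toComplex (EuclideanSpace.basisFun (Fin n) ℝ j) =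
      EuclideanSpace.basisFun (Fin n) ℂ j := fun j => by
    ext k
    simp [toComplex, apply_ite Complex.ofReal]
  simp_rw [htoComplex]
  rw [← Finset.sum_mul, OrthonormalBasis.sum_sq_norm_inner_right, hA.eigenvectorBasis.norm_eq_one,
    one_pow, one_mul]

/-- Since the `v` are real, only the real part of `f(A)` enters the quadratic form `vᴴ f(A) v`. -/
theorem exists_diagForm_eq_integral_weightedCESM (f : ℝ → ℝ) :
    ∃ (b : OrthonormalBasis (Fin n) ℝ (EuclideanSpace ℝ (Fin n))) (β : Fin n → ℝ),
      ∀ v, ∫ x, f x ∂weightedCESM hA v = diagForm b β v := by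
  obtain ⟨b, β, hform⟩ := exists_diagForm_eq_sum_mul_inner_sq (n := n) (by simp)
    (Sum.elim (fun i => f (hA.eigenvalues i)) fun i => f (hA.eigenvalues i))
    (Sum.elim (fun i => WithLp.toLp 2 fun j => (hA.eigenvectorBasis i j).re)
      fun i => WithLp.toLp 2 fun j => (hA.eigenvectorBasis i j).im)
  refine ⟨b, β, fun v => ?_⟩
  rw [← hform, Fintype.sum_sum_type, ← Finset.sum_add_distrib, integral_weightedCESM]
  refine Finset.sum_congr rfl fun i _ => ?_
  rw [norm_inner_toComplex_sq, add_mul, mul_comm, mul_comm (_ ^ 2)]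
  rfl

theorem hasSubgaussianMGF_integral_weightedCESM (hn : 0 < n) {s : Set ℝ}
    (hspec : ∀ i, hA.eigenvalues i ∈ s) {f : ℝ → ℝ} {lo hi : ℝ}
    (hf : ∀ x ∈ s, f x ∈ Set.Icc lo hi) :
    HasSubgaussianMGF (fun v : Metric.sphere (0 : EuclideanSpace ℝ (Fin n)) 1 =>
        ∫ x, f x ∂weightedCESM hA v - (n : ℝ)⁻¹ * ∑ i, f (hA.eigenvalues i))
      (Real.toNNReal ((hi - lo) ^ 2 / (2 * (n + 2)))) (unifSphere n) := by
  obtain ⟨b, β, hform⟩ := exists_diagForm_eq_integral_weightedCESM hA f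
  have hβ : ∀ i, β i ∈ Set.Icc lo hi := fun i => by
    have := isProbabilityMeasure_weightedCESM hA (b.norm_eq_one i)
    rw [← diagForm_basis b β i, ← hform]
    exact (convex_Icc lo hi).integral_mem isClosed_Icc
      ((ae_weightedCESM_mem hA hspec _).mono hf) (integrable_weightedCESM hA _ f)
  have hsum : ∑ i, f (hA.eigenvalues i) = ∑ i, β i := by
    rw [← sum_integral_weightedCESM_single hA f, ← sum_diagForm_basis b β
      (EuclideanSpace.basisFun (Fin n) ℝ)]
    exact Finset.sum_congr rfl fun j _ => hform _
  have := isProbabilityMeasure_unifSphere hn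
  have : Nonempty (Fin n) := ⟨⟨0, hn⟩⟩
  simpa only [hform, hsum, Fintype.card_fin] using
    hasSubgaussianMGF_diagForm b β (isIsometryInvariant_unifSphere n) hβ

end WeightedCESM

/-! ### Averaged spectral measures -/

section AvgMeasure

variable {nv : ℕ} {Ψ : Fin nv → Measure ℝ}

theorem isProbabilityMeasure_avgMeasure (hnv : 0 < nv) [∀ l, IsProbabilityMeasure (Ψ l)] :
    IsProbabilityMeasure (avgMeasure Ψ) :=
  ⟨by simpa [avgMeasure] using
    ENNReal.inv_mul_cancel (Nat.cast_ne_zero.mpr hnv.ne') (ENNReal.natCast_ne_top nv)⟩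

theorem ae_avgMeasure {p : ℝ → Prop} (h : ∀ l, ∀ᵐ x ∂Ψ l, p x) : ∀ᵐ x ∂avgMeasure Ψ, p x :=
  Measure.ae_smul_measure (ae_finsetSum_measure_iff.mpr fun l _ => h l) _

theorem integrable_avgMeasure {g : ℝ → ℝ} (hnv : 0 < nv) (hg : ∀ l, Integrable g (Ψ l)) :
    Integrable g (avgMeasure Ψ) :=
  (integrable_finsetSum_measure.mpr fun l _ => hg l).smul_measure (by simp [hnv.ne'])

theorem integral_avgMeasure {g : ℝ → ℝ} (hg : ∀ l, Integrable g (Ψ l)) :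
    ∫ x, g x ∂avgMeasure Ψ = (nv : ℝ)⁻¹ * ∑ l, ∫ x, g x ∂Ψ l := by
  rw [avgMeasure, integral_smul_measure, integral_finsetSum_measure fun l _ => hg l]
  simp

theorem quadError_le_average {s : ℕ} (T : PolyApprox s) {f : ℝ → ℝ}
    (hf : ∀ l, Integrable f (Ψ l)) :
    quadError T Ψ f ≤ (nv : ℝ)⁻¹ *
      ∑ l, |∫ x, f x ∂Ψ l - ∫ x, (T.toPoly (Ψ l) f).eval x ∂Ψ l| := by
  rw [quadError, quadIntegral, integral_avgMeasure hf, ← mul_sub, ← Finset.sum_sub_distrib,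
    abs_mul, abs_inv, Nat.abs_cast]
  gcongr
  exact Finset.abs_sum_le_sum_abs _ _

end AvgMeasure

section Concentration

variable {n nv : ℕ} {A : Matrix (Fin n) (Fin n) ℂ} (hA : A.IsHermitian)

theorem norm_trace_cfc_sub_quadIntegral_le {s : ℕ} (T : PolyApprox s) (Ψ : Fin nv → Measure ℝ)
    (f : ℝ → ℝ) :
    ‖(n : ℂ)⁻¹ * (hA.cfc f).trace - ((quadIntegral T Ψ f : ℝ) : ℂ)‖ ≤
      |∫ x, f x ∂avgMeasure Ψ - (n : ℝ)⁻¹ * ∑ i, f (hA.eigenvalues i)| + quadError T Ψ f := by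
  rw [trace_cfc, abs_sub_comm, quadError]
  refine le_trans (le_of_eq ?_) (abs_sub_le _ _ _)
  rw [← Real.norm_eq_abs, ← Complex.norm_real]
  push_cast
  rfl

theorem abs_integral_avgMeasure_sub_mean_le (hn : 0 < n) (hnv : 0 < nv) {s : Set ℝ}
    (hspec : ∀ i, hA.eigenvalues i ∈ s) {f : ℝ → ℝ} {lo hi : ℝ}
    (hf : ∀ x ∈ s, f x ∈ Set.Icc lo hi)
    (v : Fin nv → Metric.sphere (0 : EuclideanSpace ℝ (Fin n)) 1) :
    |∫ x, f x ∂avgMeasure (fun l => weightedCESM hA (v l)) -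
      (n : ℝ)⁻¹ * ∑ i, f (hA.eigenvalues i)| ≤ hi - lo := by
  have := fun l => isProbabilityMeasure_weightedCESM hA (norm_eq_of_mem_sphere (v l))
  have := isProbabilityMeasure_avgMeasure (Ψ := fun l => weightedCESM hA (v l)) hnv
  have hint := (convex_Icc lo hi).integral_mem isClosed_Icc
    ((ae_avgMeasure fun l => ae_weightedCESM_mem hA hspec (v l)).mono hf)
    (integrable_avgMeasure hnv fun l => integrable_weightedCESM hA (v l) f)
  have hmean : ∑ i, (n : ℝ)⁻¹ • f (hA.eigenvalues i) ∈ Set.Icc lo hi :=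
    (convex_Icc lo hi).sum_mem (fun _ _ => by positivity) (by simp [hn.ne'])
      fun i _ => hf _ (hspec i)
  simp only [smul_eq_mul, ← Finset.mul_sum] at hmean
  exact abs_sub_le_of_le_of_le hint.1 hint.2 hmean.1 hmean.2

variable {Ω : Type*} [MeasurableSpace Ω] {P : Measure Ω}
  {v : Fin nv → Ω → Metric.sphere (0 : EuclideanSpace ℝ (Fin n)) 1}

theorem measureReal_le_abs_integral_avgMeasure_sub_le (hn : 0 < n) (hnv : 0 < nv) {s : Set ℝ}
    (hspec : ∀ i, hA.eigenvalues i ∈ s) {f : ℝ → ℝ} {lo hi : ℝ}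
    (hf : ∀ x ∈ s, f x ∈ Set.Icc lo hi)
    (hlaw : ∀ l, HasLaw (v l) (unifSphere n) P) (hindep : iIndepFun v P) {ε : ℝ} (hε : 0 ≤ ε) :
    P.real {ω | ε ≤ |∫ x, f x ∂avgMeasure (fun l => weightedCESM hA (v l ω)) -
        (n : ℝ)⁻¹ * ∑ i, f (hA.eigenvalues i)|} ≤
      2 * Real.exp (-(nv * (n + 2) * ε ^ 2 / (hi - lo) ^ 2)) := by
  have : Nonempty (Fin nv) := ⟨⟨0, hnv⟩⟩
  set deviation : Metric.sphere (0 : EuclideanSpace ℝ (Fin n)) 1 → ℝ := fun w =>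
    ∫ x, f x ∂weightedCESM hA w - (n : ℝ)⁻¹ * ∑ i, f (hA.eigenvalues i) with hdev
  have hsub := hasSubgaussianMGF_integral_weightedCESM hA hn hspec hf
  have hmeas : Measurable deviation := by
    obtain ⟨b, β, hform⟩ := exists_diagForm_eq_integral_weightedCESM hA f
    simp only [hdev, hform]
    exact Continuous.measurable (by fun_prop)
  have hle := measureReal_le_abs_average_le (X := fun l ω => deviation (v l ω))
    (hindep.comp (fun _ => deviation) fun _ => hmeas)
    (fun l => HasSubgaussianMGF.of_map (X := deviation) (hlaw l).aemeasurable
      (by rw [(hlaw l).map_eq]; exact hsub)) hε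
  have haverage : ∀ ω, ∫ x, f x ∂avgMeasure (fun l => weightedCESM hA (v l ω)) -
      (n : ℝ)⁻¹ * ∑ i, f (hA.eigenvalues i) = (nv : ℝ)⁻¹ * ∑ l, deviation (v l ω) := fun ω => by
    have hnv0 : (nv : ℝ) ≠ 0 := Nat.cast_ne_zero.mpr hnv.ne'
    rw [integral_avgMeasure fun l => integrable_weightedCESM hA _ f, Finset.sum_sub_distrib,
      Finset.sum_const, Finset.card_univ, Fintype.card_fin, nsmul_eq_mul, mul_sub,
      inv_mul_cancel_left₀ hnv0]
  simp_rw [haverage]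
  rw [Fintype.card_fin, Real.coe_toNNReal _ (by positivity)] at hle
  convert! hle using 4
  field_simp

theorem measureReal_norm_trace_cfc_sub_quadIntegral_gt_le (hn : 0 < n)
    (hnv : 0 < nv) {S : Set ℝ}
    (hspec : ∀ i, hA.eigenvalues i ∈ S) {f : ℝ → ℝ} {lo hi : ℝ}
    (hf : ∀ x ∈ S, f x ∈ Set.Icc lo hi) (hlaw : ∀ l, HasLaw (v l) (unifSphere n) P)
    (hindep : iIndepFun v P) {s : ℕ} (T : PolyApprox s) {ε : ℝ} (hε : 0 < ε) :
    P.real {ω | ‖(n : ℂ)⁻¹ * (hA.cfc f).trace -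
          ((quadIntegral T (fun l => weightedCESM hA (v l ω)) f : ℝ) : ℂ)‖
          > ε + quadError T (fun l => weightedCESM hA (v l ω)) f} ≤
      if lo < hi then 2 * Real.exp (-(nv * (n + 2) * ε ^ 2 / (hi - lo) ^ 2)) else 0 := by
  have := hindep.isProbabilityMeasure
  refine (measureReal_mono (s₂ := {ω | ε ≤ |∫ x, f x ∂avgMeasure (fun l => weightedCESM hA (v l ω))
    - (n : ℝ)⁻¹ * ∑ i, f (hA.eigenvalues i)|}) (fun ω hω => ?_)).trans ?_
  · rw [Set.mem_ofPred_eq] at hω ⊢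
    linarith [norm_trace_cfc_sub_quadIntegral_le hA T (fun l => weightedCESM hA (v l ω)) f]
  · split_ifs with hlt
    · exact measureReal_le_abs_integral_avgMeasure_sub_le hA hn hnv hspec hf hlaw hindep hε.le
    · refine le_of_eq ?_
      convert! measureReal_empty
      refine Set.eq_empty_of_forall_notMem fun ω hω => ?_
      rw [Set.mem_ofPred_eq] at hω
      linarith [abs_integral_avgMeasure_sub_mean_le hA hn hnv hspec hf fun l => v l ω]

end Concentration

/-! ### Orthogonal polynomials -/

theorem degree_monicOrth_correction_lt (ν : Measure ℝ) (j : ℕ) :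
    (∑ i : Fin j, C ((∫ x, x ^ j * (monicOrth ν i).eval x ∂ν) /
      ∫ x, (monicOrth ν i).eval x ^ 2 ∂ν) * monicOrth ν i).degree < (j : WithBot ℕ) := by
  rw [← mem_degreeLT]
  refine Submodule.sum_mem _ fun i _ => ?_
  rw [← smul_eq_C_mul]
  refine Submodule.smul_mem _ _ (mem_degreeLT.mpr (degree_le_natDegree.trans_lt ?_))
  exact_mod_cast (natDegree_monicOrth_le ν i).trans_lt i.2

theorem monic_monicOrth (ν : Measure ℝ) (j : ℕ) : (monicOrth ν j).Monic := by
  rw [monicOrth]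
  exact (monic_X_pow j).sub_of_left
    ((degree_monicOrth_correction_lt ν j).trans_eq (degree_X_pow j).symm)

theorem degree_monicOrth (ν : Measure ℝ) (j : ℕ) : (monicOrth ν j).degree = j := by
  rw [monicOrth, degree_sub_eq_left_of_degree_lt, degree_X_pow]
  exact (degree_monicOrth_correction_lt ν j).trans_eq (degree_X_pow j).symm

theorem natDegree_monicOrth (ν : Measure ℝ) (j : ℕ) : (monicOrth ν j).natDegree = j :=
  natDegree_eq_of_degree_eq_some (degree_monicOrth ν j)

theorem span_monicOrth (ν : Measure ℝ) (k : ℕ) :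
    Submodule.span ℝ (monicOrth ν '' Set.Iio k) = degreeLT ℝ k :=
  Polynomial.Sequence.span_degreeLT ⟨monicOrth ν, degree_monicOrth ν⟩ fun i _ =>
    by simp [(monic_monicOrth ν i).leadingCoeff]

theorem degree_lt_of_monicOrth_eq_mul {ν : Measure ℝ} {k : ℕ} {g q : ℝ[X]}
    (hfactor : monicOrth ν k = g * q) (hg : 0 < g.natDegree) : q.degree < (k : WithBot ℕ) := by
  have hgq := (monic_monicOrth ν k).ne_zero
  rw [hfactor] at hgq
  have hsum := natDegree_mul (left_ne_zero_of_mul hgq) (right_ne_zero_of_mul hgq)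
  rw [← hfactor, natDegree_monicOrth] at hsum
  rw [degree_eq_natDegree (right_ne_zero_of_mul hgq), Nat.cast_lt]
  omega

/-- The orthogonal polynomials of `ν` of degree less than `k` have nonzero norm, so that the
Gram–Schmidt recursion does not break down before degree `k`. -/
def HasOrthogonalPolys (ν : Measure ℝ) (k : ℕ) : Prop :=
  ∀ i < k, (∫ x, (monicOrth ν i).eval x ^ 2 ∂ν) ≠ 0

theorem HasOrthogonalPolys.mono {ν : Measure ℝ} {j k : ℕ} (hk : HasOrthogonalPolys ν k)
    (hjk : j ≤ k) : HasOrthogonalPolys ν j := fun i hi => hk i (hi.trans_le hjk)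

section Orthogonality

variable {ν : Measure ℝ} (hint : ∀ p : ℝ[X], Integrable (fun x => p.eval x) ν)

/-- Integration of polynomials against a measure with finite moments, as a linear functional. -/
def polyIntegral (hint : ∀ p : ℝ[X], Integrable (fun x => p.eval x) ν) : ℝ[X] →ₗ[ℝ] ℝ where
  toFun p := ∫ x, p.eval x ∂ν
  map_add' p q := by
    simp only [eval_add]
    exact integral_add (hint p) (hint q)
  map_smul' c p := by
    simp only [eval_smul, RingHom.id_apply]
    exact integral_smul c _

theorem polyIntegral_apply (p : ℝ[X]) : polyIntegral hint p = ∫ x, p.eval x ∂ν := rfl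

theorem polyIntegral_C_mul (c : ℝ) (p : ℝ[X]) :
    polyIntegral hint (C c * p) = c * polyIntegral hint p := by
  rw [← smul_eq_C_mul, map_smul, smul_eq_mul]

theorem polyIntegral_mul_self (p : ℝ[X]) :
    polyIntegral hint (p * p) = ∫ x, p.eval x ^ 2 ∂ν := by
  simp only [polyIntegral_apply, eval_mul, sq]

theorem polyIntegral_monicOrth_mul_monicOrth {i j : ℕ} (hj : HasOrthogonalPolys ν j) (hij : i < j) :
    polyIntegral hint (monicOrth ν j * monicOrth ν i) = 0 := by
  induction j using Nat.strong_induction_on generalizing i with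
  | _ j ih =>
    have hmoment : ∀ l, (∫ x, x ^ j * (monicOrth ν l).eval x ∂ν) =
        polyIntegral hint (X ^ j * monicOrth ν l) := fun l => by
      simp only [polyIntegral_apply, eval_mul, eval_pow, eval_X]
    rw [monicOrth, sub_mul, map_sub, Finset.sum_mul, map_sum]
    simp only [mul_assoc, polyIntegral_C_mul]
    rw [Finset.sum_eq_single (⟨i, hij⟩ : Fin j)]
    · rw [hmoment, polyIntegral_mul_self, div_mul_cancel₀ _ (hj i hij), sub_self]
    · intro l _ hl
      rcases lt_or_gt_of_ne (Fin.val_ne_of_ne hl) with hli | hil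
      · rw [mul_comm (monicOrth ν l), ih i hij (hj.mono hij.le) hli, mul_zero]
      · rw [ih l l.2 (hj.mono l.2.le) hil, mul_zero]
    · exact fun h => absurd (Finset.mem_univ _) h

variable {k : ℕ} (hk : HasOrthogonalPolys ν k)
include hint hk

theorem polyIntegral_monicOrth_mul {q : ℝ[X]} (hq : q.degree < (k : WithBot ℕ)) :
    polyIntegral hint (monicOrth ν k * q) = 0 := by
  have hle : degreeLT ℝ k ≤ (polyIntegral hint ∘ₗ LinearMap.mulLeft ℝ (monicOrth ν k)).ker := by
    rw [← span_monicOrth ν k, Submodule.span_le, Set.image_subset_iff]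
    exact fun i hi => polyIntegral_monicOrth_mul_monicOrth hint hk hi
  exact hle (mem_degreeLT.mpr hq)

theorem eq_zero_of_ae_eval_eq_zero {q : ℝ[X]} (hq : q.degree < (k : WithBot ℕ))
    (hae : ∀ᵐ x ∂ν, q.eval x = 0) : q = 0 := by
  by_contra hq0
  set d := q.natDegree with hd
  have hdk : d < k := by rwa [degree_eq_natDegree hq0, Nat.cast_lt] at hq
  have hlead : q.leadingCoeff ≠ 0 := leadingCoeff_ne_zero.mpr hq0
  have hrem : (q - C q.leadingCoeff * monicOrth ν d).degree < (d : WithBot ℕ) := by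
    rw [← degree_eq_natDegree hq0]
    refine degree_sub_lt_left ?_ hq0 ?_
    · rw [degree_C_mul hlead, degree_monicOrth, hd, degree_eq_natDegree hq0]
    · rw [leadingCoeff_mul, leadingCoeff_C, (monic_monicOrth ν d).leadingCoeff, mul_one]
  have horth := polyIntegral_monicOrth_mul hint (hk.mono hdk.le) hrem
  have hzero : polyIntegral hint (monicOrth ν d * q) = 0 := by
    refine integral_eq_zero_of_ae (hae.mono fun x hx => ?_)
    simp [hx]
  rw [mul_sub, map_sub, hzero, mul_left_comm, polyIntegral_C_mul, polyIntegral_mul_self, zero_sub,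
    neg_eq_zero] at horth
  exact mul_ne_zero hlead (hk d hdk) horth

/-- Orthogonality to the cofactor `q` says that `∫ g q² dν = 0`. -/
theorem ae_eval_monicOrth_eq_zero_of_dvd {g : ℝ[X]} (hdvd : g ∣ monicOrth ν k)
    (hg : 0 < g.natDegree) (hnonneg : ∀ᵐ x ∂ν, 0 ≤ g.eval x) :
    ∀ᵐ x ∂ν, (monicOrth ν k).eval x = 0 := by
  obtain ⟨q, hfactor⟩ := hdvd
  have hzero := polyIntegral_monicOrth_mul hint hk (degree_lt_of_monicOrth_eq_mul hfactor hg)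
  have heval : ∀ x, (monicOrth ν k * q).eval x = g.eval x * q.eval x ^ 2 := fun x => by
    rw [hfactor, eval_mul, eval_mul, mul_assoc, sq]
  rw [polyIntegral_apply, integral_eq_zero_iff_of_nonneg_ae
    (hnonneg.mono fun x hx => (heval x).symm ▸ mul_nonneg hx (sq_nonneg _)) (hint _)] at hzero
  filter_upwards [hzero] with x hx
  simpa [heval, hfactor] using hx

theorem not_ae_eval_pos_of_dvd {g : ℝ[X]} (hdvd : g ∣ monicOrth ν k) (hg : 0 < g.natDegree) :
    ¬ ∀ᵐ x ∂ν, 0 < g.eval x := by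
  intro hpos
  obtain ⟨q, hfactor⟩ := hdvd
  have hq : q = 0 := by
    refine eq_zero_of_ae_eval_eq_zero hint hk (degree_lt_of_monicOrth_eq_mul hfactor hg) ?_
    filter_upwards [hpos, ae_eval_monicOrth_eq_zero_of_dvd hint hk ⟨q, hfactor⟩ hg
      (hpos.mono fun x hx => hx.le)] with x hx hzero
    rw [hfactor, eval_mul] at hzero
    exact (mul_eq_zero.mp hzero).resolve_left hx.ne'
  exact (monic_monicOrth ν k).ne_zero (by rw [hfactor, hq, mul_zero])

theorem not_ae_eval_neg_of_dvd {g : ℝ[X]} (hdvd : g ∣ monicOrth ν k) (hg : 0 < g.natDegree) :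
    ¬ ∀ᵐ x ∂ν, g.eval x < 0 := by
  simpa only [eval_neg, neg_pos] using
    not_ae_eval_pos_of_dvd hint hk (neg_dvd.mpr hdvd) ((natDegree_neg g).symm ▸ hg)

theorem mem_of_isRoot_monicOrth {s : Set ℝ} (hs : s.OrdConnected) (hsupp : ∀ᵐ x ∂ν, x ∈ s) {θ : ℝ}
    (hθ : (monicOrth ν k).IsRoot θ) : θ ∈ s := by
  have hdvd := dvd_iff_isRoot.mpr hθ
  by_contra hmem
  by_cases hright : ∀ x ∈ s, θ < x
  · refine not_ae_eval_pos_of_dvd hint hk hdvd (by simp) (hsupp.mono fun x hx => ?_)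
    simpa using hright x hx
  · push Not at hright
    obtain ⟨y, hys, hyθ⟩ := hright
    refine not_ae_eval_neg_of_dvd hint hk hdvd (by simp) (hsupp.mono fun x hx => ?_)
    have hlt : x < θ := lt_of_not_ge fun hθx => hmem (hs.out hys hx ⟨hyθ, hθx⟩)
    simpa using hlt

theorem nodup_roots_monicOrth : (monicOrth ν k).roots.Nodup := by
  classical
  refine Multiset.nodup_iff_count_le_one.mpr fun θ => ?_
  rw [count_roots]
  by_contra hlt
  have hdvd : (X - C θ) ^ 2 ∣ monicOrth ν k :=
    (le_rootMultiplicity_iff (monic_monicOrth ν k).ne_zero).mp (by omega)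
  have hvanish := ae_eval_monicOrth_eq_zero_of_dvd hint hk hdvd (by simp)
    (Filter.Eventually.of_forall fun x => by rw [eval_pow]; exact sq_nonneg _)
  obtain ⟨q, hfactor⟩ := hdvd
  rw [sq, mul_assoc] at hfactor
  have hzero : (X - C θ) * q = 0 := by
    refine eq_zero_of_ae_eval_eq_zero hint hk
      (degree_lt_of_monicOrth_eq_mul hfactor (by simp)) (hvanish.mono fun x hx => ?_)
    rw [hfactor, eval_mul, eval_mul] at hx
    rw [eval_mul]
    exact (mul_eq_zero.mp hx).elim (fun h => by rw [h, zero_mul]) id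
  exact (monic_monicOrth ν k).ne_zero (by rw [hfactor, hzero, mul_zero])

theorem card_roots_monicOrth : (monicOrth ν k).roots.card = k := by
  obtain ⟨g, hfactor, hcard, hroots⟩ := exists_prod_multiset_X_sub_C_mul (monicOrth ν k)
  rw [natDegree_monicOrth] at hcard
  by_contra hne
  have hdvd : g ∣ monicOrth ν k := ⟨_, hfactor.symm.trans (mul_comm _ _)⟩
  have hg : 0 < g.natDegree := by omega
  have hg0 : ∀ x, g.eval x ≠ 0 := fun x hx => by
    have hmem := (mem_roots (ne_zero_of_natDegree_gt hg)).mpr hx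
    simp [hroots] at hmem
  obtain ⟨x, hx⟩ : ∃ x, g.eval x ≤ 0 := by
    by_contra! hpos
    exact not_ae_eval_pos_of_dvd hint hk hdvd hg (Filter.Eventually.of_forall hpos)
  obtain ⟨y, hy⟩ : ∃ y, 0 ≤ g.eval y := by
    by_contra! hneg
    exact not_ae_eval_neg_of_dvd hint hk hdvd hg (Filter.Eventually.of_forall hneg)
  obtain ⟨z, hz⟩ := mem_range_of_exists_le_of_exists_ge g.continuous ⟨x, hx⟩ ⟨y, hy⟩
  exact hg0 z hz

theorem card_orthNodes : (orthNodes ν k).card = k := by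
  rw [orthNodes, Multiset.toFinset_card_of_nodup (nodup_roots_monicOrth hint hk),
    card_roots_monicOrth hint hk]

end Orthogonality

theorem mem_orthNodes {ν : Measure ℝ} {k : ℕ} {θ : ℝ} :
    θ ∈ orthNodes ν k ↔ (monicOrth ν k).eval θ = 0 := by
  rw [orthNodes, Multiset.mem_toFinset, mem_roots (monic_monicOrth ν k).ne_zero, IsRoot]

/-! ### Interpolatory quadrature -/

theorem eval_nodeInterp {t : Finset ℝ} {θ : ℝ} (hθ : θ ∈ t) (f : ℝ → ℝ) :
    (nodeInterp t f).eval θ = f θ :=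
  Lagrange.eval_interpolate_at_node (v := id) f Function.injective_id.injOn hθ

theorem nodeInterp_eq_of_eval_eq {t : Finset ℝ} {f : ℝ → ℝ} {p : ℝ[X]}
    (hp : p.degree < (t.card : WithBot ℕ)) (heval : ∀ θ ∈ t, p.eval θ = f θ) :
    nodeInterp t f = p :=
  (Lagrange.eq_interpolate_of_eval_eq (v := id) f Function.injective_id.injOn hp heval).symm

theorem degree_lt_of_natDegree_le {p : ℝ[X]} {s : ℕ} (hp : p.natDegree ≤ s) :
    p.degree < ((s + 1 : ℕ) : WithBot ℕ) :=
  degree_le_natDegree.trans_lt (by exact_mod_cast Nat.lt_succ_of_le hp)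

section Exactness

variable {ν : Measure ℝ} (hint : ∀ p : ℝ[X], Integrable (fun x => p.eval x) ν)
include hint

theorem integral_nodeInterp (t : Finset ℝ) (f : ℝ → ℝ) :
    ∫ x, (nodeInterp t f).eval x ∂ν =
      ∑ θ ∈ t, f θ * ∫ x, (Lagrange.basis t id θ).eval x ∂ν := by
  rw [← polyIntegral_apply hint, nodeInterp, Lagrange.interpolate_apply, map_sum]
  exact Finset.sum_congr rfl fun θ _ => polyIntegral_C_mul hint _ _

theorem ae_eval_eq_zero_of_integral_sq_eq_zero {p : ℝ[X]}
    (hp : ∫ x, p.eval x ^ 2 ∂ν = 0) : ∀ᵐ x ∂ν, p.eval x = 0 := by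
  simp only [← eval_pow] at hp
  filter_upwards [(integral_eq_zero_iff_of_nonneg
    (fun x => by rw [eval_pow]; exact sq_nonneg _) (hint (p ^ 2))).mp hp] with x hx
  rwa [eval_pow, Pi.zero_apply, sq_eq_zero_iff] at hx

variable {k : ℕ} (hk : HasOrthogonalPolys ν k)
include hk

theorem nodeInterp_orthNodes_eval (p : ℝ[X]) :
    nodeInterp (orthNodes ν k) (fun x => p.eval x) = p %ₘ monicOrth ν k := by
  refine nodeInterp_eq_of_eval_eq ?_ fun θ hθ => ?_
  · rw [card_orthNodes hint hk, ← degree_monicOrth ν k]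
    exact degree_modByMonic_lt p (monic_monicOrth ν k)
  · conv_rhs => rw [← modByMonic_add_div p (monicOrth ν k)]
    rw [eval_add, eval_mul, mem_orthNodes.mp hθ, zero_mul, add_zero]

theorem integral_nodeInterp_orthNodes {p : ℝ[X]} (hp : p.degree < ((2 * k : ℕ) : WithBot ℕ)) :
    ∫ x, (nodeInterp (orthNodes ν k) (fun x => p.eval x)).eval x ∂ν = ∫ x, p.eval x ∂ν := by
  have hmonic := monic_monicOrth ν k
  have hdiv : (p /ₘ monicOrth ν k).degree < (k : WithBot ℕ) := by
    by_cases hzero : p /ₘ monicOrth ν k = 0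
    · rw [hzero, degree_zero]
      exact WithBot.bot_lt_coe k
    · have hle : (monicOrth ν k).degree ≤ p.degree :=
        le_of_not_gt fun hlt => hzero ((divByMonic_eq_zero_iff hmonic).mpr hlt)
      have hsum := degree_add_divByMonic hmonic hle
      rw [degree_monicOrth, degree_eq_natDegree hzero] at hsum
      rw [← hsum] at hp
      rw [degree_eq_natDegree hzero]
      norm_cast at hp ⊢
      omega
  simp only [nodeInterp_orthNodes_eval hint hk, ← polyIntegral_apply hint]
  conv_rhs => rw [← modByMonic_add_div p (monicOrth ν k), map_add,
    polyIntegral_monicOrth_mul hint hk hdiv, add_zero]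

/-- The weight at `θ` is the integral of the square of the Lagrange basis polynomial `ℓ_θ`, because
the rule is exact for `ℓ_θ ^ 2`. -/
theorem integral_basis_orthNodes_nonneg {θ : ℝ} (hθ : θ ∈ orthNodes ν k) :
    0 ≤ ∫ x, (Lagrange.basis (orthNodes ν k) id θ).eval x ∂ν := by
  set ℓ := Lagrange.basis (orthNodes ν k) id θ with hℓ
  have hdeg : (ℓ ^ 2).degree < ((2 * k : ℕ) : WithBot ℕ) := by
    have hpos : 0 < k := (Finset.card_pos.mpr ⟨θ, hθ⟩).trans_le (card_orthNodes_le ν k)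
    rw [degree_pow, hℓ, Lagrange.degree_basis Function.injective_id.injOn hθ,
      card_orthNodes hint hk, nsmul_eq_mul]
    norm_cast
    omega
  have hsq : ∀ η ∈ orthNodes ν k, ℓ.eval η = (ℓ ^ 2).eval η := fun η hη => by
    rcases eq_or_ne η θ with rfl | hne
    · have hone : ℓ.eval η = 1 := Lagrange.eval_basis_self Function.injective_id.injOn hη
      rw [eval_pow, hone, one_pow]
    · have hzero : ℓ.eval η = 0 := Lagrange.eval_basis_of_ne (v := id) hne.symm hη
      rw [eval_pow, hzero, zero_pow two_ne_zero]
  have hinterp : nodeInterp (orthNodes ν k) (fun x => (ℓ ^ 2).eval x) = ℓ := by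
    refine nodeInterp_eq_of_eval_eq ?_ hsq
    rw [hℓ, Lagrange.degree_basis Function.injective_id.injOn hθ]
    exact_mod_cast Nat.pred_lt (Finset.card_pos.mpr ⟨θ, hθ⟩).ne'
  have hexact := integral_nodeInterp_orthNodes hint hk hdeg
  rw [hinterp] at hexact
  rw [hexact]
  exact integral_nonneg fun x => by rw [eval_pow]; exact sq_nonneg _

end Exactness

section GaussNodes

variable {ν : Measure ℝ} (hint : ∀ p : ℝ[X], Integrable (fun x => p.eval x) ν)

theorem exists_gaussNodes_eq_orthNodes (ν : Measure ℝ) (k : ℕ) :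
    ∃ m, gaussNodes ν k = orthNodes ν m ∧ HasOrthogonalPolys ν m ∧
      (m = k ∨ ∫ x, (monicOrth ν m).eval x ^ 2 ∂ν = 0) := by
  classical
  have hspec : HasOrthogonalPolys ν (Nat.findGreatest (HasOrthogonalPolys ν) k) :=
    Nat.findGreatest_spec (Nat.zero_le k) fun i hi => absurd hi (Nat.not_lt_zero i)
  refine ⟨_, ?_, hspec, ?_⟩
  · simp only [gaussNodes]
    congr
  · set m := Nat.findGreatest (HasOrthogonalPolys ν) k
    by_contra! hlast
    have hsucc : HasOrthogonalPolys ν (m + 1) := fun i hi => by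
      rcases Nat.lt_succ_iff_lt_or_eq.mp hi with hlt | rfl
      exacts [hspec i hlt, hlast.2]
    have hle : m ≤ k := Nat.findGreatest_le k
    have hmax : m + 1 ≤ m := Nat.le_findGreatest (by omega) hsucc
    omega

include hint

theorem mem_of_mem_gaussNodes {k : ℕ} {s : Set ℝ} (hs : s.OrdConnected)
    (hsupp : ∀ᵐ x ∂ν, x ∈ s) {θ : ℝ} (hθ : θ ∈ gaussNodes ν k) : θ ∈ s := by
  obtain ⟨m, hnodes, horth, -⟩ := exists_gaussNodes_eq_orthNodes ν k
  exact mem_of_isRoot_monicOrth hint horth hs hsupp (mem_orthNodes.mp (hnodes ▸ hθ))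

theorem integral_basis_gaussNodes_nonneg {k : ℕ} {θ : ℝ} (hθ : θ ∈ gaussNodes ν k) :
    0 ≤ ∫ x, (Lagrange.basis (gaussNodes ν k) id θ).eval x ∂ν := by
  obtain ⟨m, hnodes, horth, -⟩ := exists_gaussNodes_eq_orthNodes ν k
  rw [hnodes] at hθ ⊢
  exact integral_basis_orthNodes_nonneg hint horth hθ

theorem integral_nodeInterp_gaussNodes {k : ℕ} {p : ℝ[X]}
    (hp : p.degree < ((2 * k : ℕ) : WithBot ℕ)) :
    ∫ x, (nodeInterp (gaussNodes ν k) (fun x => p.eval x)).eval x ∂ν = ∫ x, p.eval x ∂ν := by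
  obtain ⟨m, hnodes, horth, rfl | hbreakdown⟩ := exists_gaussNodes_eq_orthNodes ν k
  · rw [hnodes, integral_nodeInterp_orthNodes hint horth hp]
  · refine integral_congr_ae ?_
    filter_upwards [ae_eval_eq_zero_of_integral_sq_eq_zero hint hbreakdown] with x hx
    rw [hnodes, eval_nodeInterp (mem_orthNodes.mpr hx)]

end GaussNodes

/-! ### Signed measures -/

section SignedMeasures

variable {α : Type*} [MeasurableSpace α]

theorem isFiniteMeasure_variation (Q : SignedMeasure α) : IsFiniteMeasure Q.variation := by
  rw [← SignedMeasure.totalVariation_eq_variation, SignedMeasure.totalVariation]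
  infer_instance

theorem variation_univ_of_nonneg {Q : SignedMeasure α} (hQ : 0 ≤ Q) :
    Q.variation.real Set.univ = Q Set.univ := by
  have hQ' := (VectorMeasure.le_restrict_univ_iff_le 0 Q).mpr hQ
  conv_lhs => rw [← SignedMeasure.toMeasureOfZeroLE_toSignedMeasure Q hQ']
  conv_rhs => rw [← SignedMeasure.toMeasureOfZeroLE_toSignedMeasure Q hQ']
  rw [Measure.variation_toSignedMeasure,
    Measure.toSignedMeasure_apply_measurable MeasurableSet.univ]

theorem ae_variation_smul {Q : SignedMeasure α} {p : α → Prop} (c : ℝ)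
    (h : ∀ᵐ x ∂Q.variation, p x) : ∀ᵐ x ∂(c • Q).variation, p x := by
  rw [VectorMeasure.variation_smul]
  exact Measure.ae_smul_measure h _

theorem ae_variation_finsetSum {ι : Type*} {s : Finset ι} {Q : ι → SignedMeasure α} {p : α → Prop}
    (h : ∀ i ∈ s, ∀ᵐ x ∂(Q i).variation, p x) : ∀ᵐ x ∂(∑ i ∈ s, Q i).variation, p x := by
  refine (VectorMeasure.variation_finsetSum_le s Q).absolutelyContinuous.ae_le ?_
  exact ae_finsetSum_measure_iff.mpr h

theorem integral_real_toSignedMeasure (m : Measure α) [IsFiniteMeasure m] (f : α → ℝ) :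
    ∫ᵛ x, f x ∂•m.toSignedMeasure = ∫ x, f x ∂m := by
  have hflip : (ContinuousLinearMap.lsmul ℝ ℝ : ℝ →L[ℝ] ℝ →L[ℝ] ℝ).flip =
      ContinuousLinearMap.lsmul ℝ ℝ := by
    ext
    simp
  rw [← VectorMeasure.integral_toSignedMeasure, hflip]

theorem abs_integral_le_variation_mul {Q : SignedMeasure α} {g : α → ℝ} {M : ℝ}
    (hg : ∀ᵐ x ∂Q.variation, |g x| ≤ M) :
    |∫ᵛ x, g x ∂•Q| ≤ Q.variation.real Set.univ * M := by
  have := isFiniteMeasure_variation Q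
  have hnorm : ‖(ContinuousLinearMap.lsmul ℝ ℝ : ℝ →L[ℝ] ℝ →L[ℝ] ℝ)‖ = 1 :=
    ContinuousLinearMap.opNorm_lsmul ℝ ℝ
  have hle := VectorMeasure.norm_integral_le_of_norm_le_const (μ := Q)
    (B := ContinuousLinearMap.lsmul ℝ ℝ) hg
  rwa [hnorm, mul_one, mul_comm] at hle

variable {μ : Measure α} {f g : α → ℝ}

theorem integrable_max_zero_mul (hg : AEMeasurable g μ)
    (hgf : Integrable (fun x => g x * f x) μ) : Integrable (fun x => max (g x) 0 * f x) μ := by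
  refine (hgf.indicator₀ (s := {x | 0 < g x}) (nullMeasurableSet_lt aemeasurable_const hg)).congr
    (Filter.Eventually.of_forall fun x => ?_)
  rcases lt_or_ge 0 (g x) with hpos | hneg
  · simp [hpos, hpos.le]
  · simp [hneg, hneg.not_gt]

theorem integrable_withDensity_ofReal (hg : AEMeasurable g μ)
    (hgf : Integrable (fun x => g x * f x) μ) :
    Integrable f (μ.withDensity fun x => ENNReal.ofReal (g x)) := by
  rw [integrable_withDensity_iff_integrable_smul₀' hg.ennreal_ofReal
    (Filter.Eventually.of_forall fun _ => ENNReal.ofReal_lt_top)]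
  simpa only [ENNReal.toReal_ofReal', smul_eq_mul] using integrable_max_zero_mul hg hgf

theorem integral_withDensity_ofReal (hg : AEMeasurable g μ) :
    ∫ x, f x ∂(μ.withDensity fun x => ENNReal.ofReal (g x)) = ∫ x, max (g x) 0 * f x ∂μ := by
  rw [integral_withDensity_eq_integral_toReal_smul₀ hg.ennreal_ofReal
    (Filter.Eventually.of_forall fun _ => ENNReal.ofReal_lt_top)]
  simp only [ENNReal.toReal_ofReal', smul_eq_mul]

theorem integrable_withDensityᵥ (hg : Integrable g μ) (hgf : Integrable (fun x => g x * f x) μ) :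
    (μ.withDensityᵥ g).Integrable f := by
  have hgf_neg : Integrable (fun x => -g x * f x) μ := by
    simp only [neg_mul]
    exact hgf.neg
  have := isFiniteMeasure_withDensity_ofReal hg.2
  have := isFiniteMeasure_withDensity_ofReal hg.neg.2
  rw [withDensityᵥ_eq_withDensity_pos_part_sub_withDensity_neg_part hg]
  refine VectorMeasure.Integrable.sub_vectorMeasure ?_ ?_ <;>
    rw [VectorMeasure.Integrable, Measure.variation_toSignedMeasure]
  · exact integrable_withDensity_ofReal hg.aemeasurable hgf
  · exact integrable_withDensity_ofReal hg.neg.aemeasurable hgf_neg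

theorem integral_withDensityᵥ (hg : Integrable g μ) (hgf : Integrable (fun x => g x * f x) μ) :
    ∫ᵛ x, f x ∂•(μ.withDensityᵥ g) = ∫ x, g x * f x ∂μ := by
  have hgf_neg : Integrable (fun x => -g x * f x) μ := by
    simp only [neg_mul]
    exact hgf.neg
  have hm := hg.aemeasurable
  have hm_neg : AEMeasurable (fun x => -g x) μ := hm.neg
  have := isFiniteMeasure_withDensity_ofReal hg.2
  have : IsFiniteMeasure (μ.withDensity fun x => ENNReal.ofReal (-g x)) :=
    isFiniteMeasure_withDensity_ofReal hg.neg.2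
  rw [withDensityᵥ_eq_withDensity_pos_part_sub_withDensity_neg_part hg,
    VectorMeasure.integral_sub_vectorMeasure, integral_real_toSignedMeasure,
    integral_real_toSignedMeasure, integral_withDensity_ofReal hm,
    integral_withDensity_ofReal hm_neg,
    ← integral_sub (integrable_max_zero_mul hm hgf) (integrable_max_zero_mul hm_neg hgf_neg)]
  · simp only [← sub_mul, max_zero_sub_max_neg_zero_eq_self]
  · rw [VectorMeasure.Integrable, Measure.variation_toSignedMeasure]
    exact integrable_withDensity_ofReal hm hgf
  · rw [VectorMeasure.Integrable, Measure.variation_toSignedMeasure]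
    exact integrable_withDensity_ofReal hm_neg hgf_neg

theorem ae_variation_withDensityᵥ {p : α → Prop} (hg : Integrable g μ) (hp : ∀ᵐ x ∂μ, p x) :
    ∀ᵐ x ∂(μ.withDensityᵥ g).variation, p x := by
  rw [Measure.variation_withDensityᵥ hg]
  exact (withDensity_absolutelyContinuous μ _).ae_le hp

end SignedMeasures

section NodeMeasure

theorem integrable_toSignedMeasure_dirac (θ : ℝ) (g : ℝ → ℝ) :
    (Measure.dirac θ).toSignedMeasure.Integrable g := by
  rw [VectorMeasure.Integrable, Measure.variation_toSignedMeasure]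
  exact integrable_dirac (by simp)

variable (t : Finset ℝ) (ν : Measure ℝ)

theorem integrable_nodeMeasure (g : ℝ → ℝ) : (nodeMeasure t ν).Integrable g :=
  VectorMeasure.Integrable.finsetSum_vectorMeasure fun θ _ =>
    VectorMeasure.Integrable.smul_vectorMeasure (integrable_toSignedMeasure_dirac θ g) _

theorem integral_nodeMeasure (g : ℝ → ℝ) :
    ∫ᵛ x, g x ∂•(nodeMeasure t ν) =
      ∑ θ ∈ t, g θ * ∫ x, (Lagrange.basis t id θ).eval x ∂ν := by
  rw [nodeMeasure, VectorMeasure.integral_finsetSum_vectorMeasure fun θ _ =>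
    VectorMeasure.Integrable.smul_vectorMeasure (integrable_toSignedMeasure_dirac θ g) _]
  refine Finset.sum_congr rfl fun θ _ => ?_
  rw [VectorMeasure.integral_smul_vectorMeasure, integral_real_toSignedMeasure, integral_dirac,
    smul_eq_mul, mul_comm]

theorem nodeMeasure_univ :
    nodeMeasure t ν Set.univ = ∫ᵛ _, (1 : ℝ) ∂•(nodeMeasure t ν) := by
  rw [integral_nodeMeasure]
  simp [nodeMeasure, Measure.toSignedMeasure_apply]

variable {t ν}

theorem ae_variation_nodeMeasure {p : ℝ → Prop} (h : ∀ θ ∈ t, p θ) :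
    ∀ᵐ x ∂(nodeMeasure t ν).variation, p x := by
  refine ae_variation_finsetSum fun θ hθ => ae_variation_smul _ ?_
  rw [Measure.variation_toSignedMeasure, ae_dirac_eq]
  exact h θ hθ

theorem nodeMeasure_nonneg (h : ∀ θ ∈ t, 0 ≤ ∫ x, (Lagrange.basis t id θ).eval x ∂ν) :
    0 ≤ nodeMeasure t ν := by
  intro u hu
  have hsum : nodeMeasure t ν u = ∑ θ ∈ t, (∫ x, (Lagrange.basis t id θ).eval x ∂ν) *
      (Measure.dirac θ).toSignedMeasure u := by simp [nodeMeasure]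
  rw [hsum]
  exact Finset.sum_nonneg fun θ hθ => mul_nonneg (h θ hθ) (Measure.zero_le_toSignedMeasure _ u hu)

theorem integral_nodeMeasure_eq_integral_nodeInterp
    (hint : ∀ p : ℝ[X], Integrable (fun x => p.eval x) ν) (t : Finset ℝ) (g : ℝ → ℝ) :
    ∫ᵛ x, g x ∂•(nodeMeasure t ν) = ∫ x, (nodeInterp t g).eval x ∂ν := by
  rw [integral_nodeMeasure, integral_nodeInterp hint]

end NodeMeasure

section AvgSigned

variable {nv : ℕ} {Q : Fin nv → SignedMeasure ℝ}

theorem integrable_avgSigned {g : ℝ → ℝ} (hg : ∀ l, (Q l).Integrable g) :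
    (avgSigned Q).Integrable g :=
  VectorMeasure.Integrable.smul_vectorMeasure
    (VectorMeasure.Integrable.finsetSum_vectorMeasure fun l _ => hg l) _

theorem integral_avgSigned {g : ℝ → ℝ} (hg : ∀ l, (Q l).Integrable g) :
    ∫ᵛ x, g x ∂•(avgSigned Q) = (nv : ℝ)⁻¹ * ∑ l, ∫ᵛ x, g x ∂•(Q l) := by
  rw [avgSigned, VectorMeasure.integral_smul_vectorMeasure,
    VectorMeasure.integral_finsetSum_vectorMeasure fun l _ => hg l, smul_eq_mul]

theorem ae_variation_avgSigned {p : ℝ → Prop} (h : ∀ l, ∀ᵐ x ∂(Q l).variation, p x) :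
    ∀ᵐ x ∂(avgSigned Q).variation, p x :=
  ae_variation_smul _ (ae_variation_finsetSum fun l _ => h l)

theorem dTV_avgSigned_of_nonneg (hQ : ∀ l, 0 ≤ Q l) :
    dTV (avgSigned Q) = (nv : ℝ)⁻¹ * ∑ l, Q l Set.univ := by
  have happly : ∀ u, avgSigned Q u = (nv : ℝ)⁻¹ * ∑ l, Q l u := fun u => by simp [avgSigned]
  have hnonneg : 0 ≤ avgSigned Q := fun u hu => by
    rw [happly]
    exact mul_nonneg (by positivity) (Finset.sum_nonneg fun l _ => hQ l u hu)
  rw [dTV, variation_univ_of_nonneg hnonneg, happly]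

end AvgSigned

/-! ### Best uniform approximation -/

theorem integrable_eval_of_isCompact {ν : Measure ℝ} [IsFiniteMeasure ν] {s : Set ℝ}
    (hs : IsCompact s) (hsupp : ∀ᵐ x ∂ν, x ∈ s) (p : ℝ[X]) :
    Integrable (fun x => p.eval x) ν := by
  obtain ⟨C, hC⟩ := hs.exists_bound_of_continuousOn p.continuous.continuousOn
  exact Integrable.of_bound p.continuous.aestronglyMeasurable C (hsupp.mono hC)

section UniformNorm

variable {a b : ℝ} {f : ℝ → ℝ}

theorem abs_sub_eval_le_uniformNorm (hf : Bornology.IsBounded (f '' Set.Icc a b)) (p : ℝ[X])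
    {x : ℝ} (hx : x ∈ Set.Icc a b) :
    |f x - p.eval x| ≤ uniformNorm a b (fun x => f x - p.eval x) := by
  obtain ⟨Cf, hCf⟩ := hf.exists_norm_le
  obtain ⟨Cp, hCp⟩ := (isCompact_Icc (a := a) (b := b)).exists_bound_of_continuousOn
    p.continuous.continuousOn
  refine le_ciSup (f := fun y : Set.Icc a b => |f y - p.eval (y : ℝ)|) ⟨Cf + Cp, ?_⟩ ⟨x, hx⟩
  rintro _ ⟨y, rfl⟩
  exact (abs_sub _ _).trans (add_le_add (hCf _ ⟨y, y.2, rfl⟩) (hCp y y.2))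

theorem le_mul_bestError {s : ℕ} {e c : ℝ} (hc : 0 ≤ c)
    (h : ∀ p : ℝ[X], p.natDegree ≤ s → e ≤ c * uniformNorm a b (fun x => f x - p.eval x)) :
    e ≤ c * bestError s a b f := by
  rw [bestError, Real.mul_iInf_of_nonneg hc]
  have : Nonempty {p : ℝ[X] // p.natDegree ≤ s} := ⟨⟨0, by simp⟩⟩
  exact le_ciInf fun p => h p.1 p.2

theorem abs_integral_sub_eval_le_uniformNorm {ν : Measure ℝ} [IsProbabilityMeasure ν]
    (hsupp : ∀ᵐ x ∂ν, x ∈ Set.Icc a b) (hf : Bornology.IsBounded (f '' Set.Icc a b)) (p : ℝ[X]) :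
    |∫ x, (f x - p.eval x) ∂ν| ≤ uniformNorm a b (fun x => f x - p.eval x) := by
  simpa using norm_integral_le_of_norm_le_const (f := fun x => f x - p.eval x)
    (hsupp.mono fun x hx => abs_sub_eval_le_uniformNorm hf p hx)

theorem abs_integral_sub_integral_le_mul_bestError {ν : Measure ℝ} [IsProbabilityMeasure ν]
    {Q : SignedMeasure ℝ} {s : ℕ} (hν : ∀ᵐ x ∂ν, x ∈ Set.Icc a b)
    (hQ : ∀ᵐ x ∂Q.variation, x ∈ Set.Icc a b) (hf : Bornology.IsBounded (f '' Set.Icc a b))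
    (hfν : Integrable f ν) (hfQ : Q.Integrable f)
    (hexact : ∀ p : ℝ[X], p.natDegree ≤ s → ∫ᵛ x, p.eval x ∂•Q = ∫ x, p.eval x ∂ν) :
    |∫ x, f x ∂ν - ∫ᵛ x, f x ∂•Q| ≤ (1 + dTV Q) * bestError s a b f := by
  have hTV : 0 ≤ dTV Q := measureReal_nonneg
  refine le_mul_bestError (by positivity) fun p hp => ?_
  have := isFiniteMeasure_variation Q
  have hpQ : Q.Integrable fun x => p.eval x := integrable_eval_of_isCompact isCompact_Icc hQ p
  have hremainder : ∫ x, f x ∂ν - ∫ᵛ x, f x ∂•Q =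
      ∫ x, (f x - p.eval x) ∂ν - ∫ᵛ x, (f x - p.eval x) ∂•Q := by
    rw [integral_sub hfν (integrable_eval_of_isCompact isCompact_Icc hν p),
      VectorMeasure.integral_fun_sub hfQ hpQ, hexact p hp, sub_sub_sub_cancel_right]
  rw [hremainder, one_add_mul]
  exact (abs_sub _ _).trans (add_le_add (abs_integral_sub_eval_le_uniformNorm hν hf p)
    (abs_integral_le_variation_mul (hQ.mono fun x hx => abs_sub_eval_le_uniformNorm hf p hx)))

end UniformNorm

/-! ### Quadrature errors -/

/-- The signed measure `Q` on `[a, b]` realizes the quadrature approximation `[ν]_s` given by `T`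
for the integrand `f`, and it has degree of exactness `s`. -/
structure IsQuadratureMeasure {s : ℕ} (T : PolyApprox s) (a b : ℝ) (f : ℝ → ℝ) (ν : Measure ℝ)
    (Q : SignedMeasure ℝ) : Prop where
  supported : ∀ᵐ x ∂Q.variation, x ∈ Set.Icc a b
  integrable : Q.Integrable f
  integral_eq : ∫ᵛ x, f x ∂•Q = ∫ x, (T.toPoly ν f).eval x ∂ν
  exact_eval : ∀ p : ℝ[X], p.natDegree ≤ s → ∫ᵛ x, p.eval x ∂•Q = ∫ x, p.eval x ∂ν

section QuadError

variable {s nv : ℕ} {T : PolyApprox s} {Ψ : Fin nv → Measure ℝ} {a b : ℝ} {f : ℝ → ℝ}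

theorem quadError_le_average_uniformNorm (T : PolyApprox s) [∀ l, IsProbabilityMeasure (Ψ l)]
    (hsupp : ∀ l, ∀ᵐ x ∂Ψ l, x ∈ Set.Icc a b) (hint : ∀ l, Integrable f (Ψ l))
    (hf : Bornology.IsBounded (f '' Set.Icc a b)) :
    quadError T Ψ f ≤
      (nv : ℝ)⁻¹ * ∑ l, uniformNorm a b (fun x => f x - (T.toPoly (Ψ l) f).eval x) := by
  refine (quadError_le_average T hint).trans ?_
  gcongr with l
  rw [← integral_sub (hint l) (integrable_eval_of_isCompact isCompact_Icc (hsupp l) _)]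
  exact abs_integral_sub_eval_le_uniformNorm (hsupp l) hf _

variable {Q : Fin nv → SignedMeasure ℝ} (hQ : ∀ l, IsQuadratureMeasure T a b f (Ψ l) (Q l))
include hQ

theorem quadIntegral_eq_integral_avgSigned :
    quadIntegral T Ψ f = ∫ᵛ x, f x ∂•(avgSigned Q) := by
  simp only [quadIntegral, integral_avgSigned fun l => (hQ l).integrable, (hQ _).integral_eq]

theorem quadError_le_mul_bestError (hnv : 0 < nv) [∀ l, IsProbabilityMeasure (Ψ l)]
    (hsupp : ∀ l, ∀ᵐ x ∂Ψ l, x ∈ Set.Icc a b) (hint : ∀ l, Integrable f (Ψ l))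
    (hf : Bornology.IsBounded (f '' Set.Icc a b)) :
    quadError T Ψ f ≤ (1 + dTV (avgSigned Q)) * bestError s a b f := by
  have := isProbabilityMeasure_avgMeasure (Ψ := Ψ) hnv
  rw [quadError, quadIntegral_eq_integral_avgSigned hQ]
  refine abs_integral_sub_integral_le_mul_bestError (ae_avgMeasure hsupp)
    (ae_variation_avgSigned fun l => (hQ l).supported) hf (integrable_avgMeasure hnv hint)
    (integrable_avgSigned fun l => (hQ l).integrable) fun p hp => ?_
  have hpQ : ∀ l, (Q l).Integrable fun x => p.eval x := fun l =>
    have := isFiniteMeasure_variation (Q l)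
    integrable_eval_of_isCompact isCompact_Icc (hQ l).supported p
  simp only [integral_avgSigned hpQ, (hQ _).exact_eval p hp,
    integral_avgMeasure fun l => integrable_eval_of_isCompact isCompact_Icc (hsupp l) p]

end QuadError

/-! ### Gaussian quadrature -/

section Gauss

variable {ν : Measure ℝ} {a b : ℝ}

theorem isQuadratureMeasure_gaussMeasure [IsFiniteMeasure ν] (hsupp : ∀ᵐ x ∂ν, x ∈ Set.Icc a b)
    (f : ℝ → ℝ) {k : ℕ} (hk : 0 < k) :
    IsQuadratureMeasure (gauss k) a b f ν (gaussMeasure k ν) where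
  supported := ae_variation_nodeMeasure fun _ hθ => mem_of_mem_gaussNodes
    (integrable_eval_of_isCompact isCompact_Icc hsupp) Set.ordConnected_Icc hsupp hθ
  integrable := integrable_nodeMeasure _ _ f
  integral_eq := integral_nodeMeasure_eq_integral_nodeInterp
    (integrable_eval_of_isCompact isCompact_Icc hsupp) _ f
  exact_eval p hp := by
    have hint := integrable_eval_of_isCompact isCompact_Icc hsupp
    have hdeg := degree_lt_of_natDegree_le hp
    rw [Nat.sub_add_cancel (by omega)] at hdeg
    rw [gaussMeasure, integral_nodeMeasure_eq_integral_nodeInterp hint,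
      integral_nodeInterp_gaussNodes hint hdeg]

theorem gaussMeasure_nonneg (hint : ∀ p : ℝ[X], Integrable (fun x => p.eval x) ν) (k : ℕ) :
    0 ≤ gaussMeasure k ν :=
  nodeMeasure_nonneg fun _ hθ => integral_basis_gaussNodes_nonneg hint hθ

theorem gaussMeasure_univ [IsProbabilityMeasure ν] (hsupp : ∀ᵐ x ∂ν, x ∈ Set.Icc a b) {k : ℕ}
    (hk : 0 < k) : gaussMeasure k ν Set.univ = 1 := by
  have hexact := (isQuadratureMeasure_gaussMeasure hsupp (fun _ => 1) hk).exact_eval 1 (by simp)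
  simp only [eval_one, integral_const, probReal_univ, smul_eq_mul, mul_one] at hexact
  rw [← hexact, gaussMeasure, nodeMeasure_univ]

theorem dTV_avgSigned_gaussMeasure {nv k : ℕ} {Ψ : Fin nv → Measure ℝ} (hnv : 0 < nv)
    [∀ l, IsProbabilityMeasure (Ψ l)] (hsupp : ∀ l, ∀ᵐ x ∂Ψ l, x ∈ Set.Icc a b) (hk : 0 < k) :
    dTV (avgSigned fun l => gaussMeasure k (Ψ l)) = 1 := by
  rw [dTV_avgSigned_of_nonneg fun l =>
    gaussMeasure_nonneg (integrable_eval_of_isCompact isCompact_Icc (hsupp l)) k]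
  simp [gaussMeasure_univ (hsupp _) hk, hnv.ne']

end Gauss

/-! ### Quadrature with respect to a reference measure -/

section Reference

variable {μ ν : Measure ℝ} {a b : ℝ} {s : ℕ}

theorem IsReference.integrable_eval (h : IsReference μ a b s) (p : ℝ[X]) :
    Integrable (fun x => p.eval x) μ :=
  have := h.isProb
  integrable_eval_of_isCompact isCompact_Icc h.supported p

theorem IsReference.hasOrthogonalPolys (h : IsReference μ a b s) :
    HasOrthogonalPolys μ (s + 1) := by
  intro i hi hzero
  have hnodes : ∀ᵐ x ∂μ, x ∈ (orthNodes μ i : Set ℝ) :=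
    (ae_eval_eq_zero_of_integral_sq_eq_zero h.integrable_eval hzero).mono
      fun x hroot => Finset.mem_coe.mpr (mem_orthNodes.mpr hroot)
  exact h.nondegenerate _ ((card_orthNodes_le μ i).trans (by omega)) hnodes

theorem isQuadratureMeasure_interpMeasure (h : IsReference μ a b s)
    (hν : ∀ p : ℝ[X], Integrable (fun x => p.eval x) ν) (f : ℝ → ℝ) :
    IsQuadratureMeasure (interp μ s) a b f ν (interpMeasure μ s ν) where
  supported := ae_variation_nodeMeasure fun _ hθ => mem_of_isRoot_monicOrth h.integrable_eval
    h.hasOrthogonalPolys Set.ordConnected_Icc h.supported (mem_orthNodes.mp hθ)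
  integrable := integrable_nodeMeasure _ _ f
  integral_eq := integral_nodeMeasure_eq_integral_nodeInterp hν _ f
  exact_eval p hp := by
    rw [interpMeasure, integral_nodeMeasure_eq_integral_nodeInterp hν,
      nodeInterp_eq_of_eval_eq (p := p) ?_ fun _ _ => rfl]
    rw [card_orthNodes h.integrable_eval h.hasOrthogonalPolys]
    exact degree_lt_of_natDegree_le hp

end Reference

section Approx

variable {μ ν : Measure ℝ} {s : ℕ} (hint : ∀ p : ℝ[X], Integrable (fun x => p.eval x) μ)

theorem polyIntegral_monicOrth_mul_orthonormalPoly {k i j : ℕ} (hk : HasOrthogonalPolys μ k)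
    (hi : i < k) (hj : j < k) :
    polyIntegral hint (monicOrth μ j * orthonormalPoly μ i) =
      if i = j then √(∫ x, (monicOrth μ j).eval x ^ 2 ∂μ) else 0 := by
  rw [orthonormalPoly, mul_left_comm, polyIntegral_C_mul]
  split_ifs with hij
  · rw [hij, polyIntegral_mul_self, inv_mul_eq_div, Real.div_sqrt]
  · rcases lt_or_gt_of_ne hij with hlt | hgt
    · rw [polyIntegral_monicOrth_mul_monicOrth hint (hk.mono hj.le) hlt, mul_zero]
    · rw [mul_comm (monicOrth μ j),
        polyIntegral_monicOrth_mul_monicOrth hint (hk.mono hi.le) hgt, mul_zero]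

theorem approx_toPoly_eval_apply (ν : Measure ℝ) (p : ℝ[X]) :
    (approx μ s).toPoly ν (fun x => p.eval x) = ∑ i ∈ Finset.range (s + 1),
      polyIntegral hint (p * orthonormalPoly μ i) • orthonormalPoly μ i := by
  simp only [approx, polyIntegral_apply, eval_mul, smul_eq_C_mul]

include hint in
theorem approx_toPoly_monicOrth (hs : HasOrthogonalPolys μ (s + 1)) (ν : Measure ℝ) {j : ℕ}
    (hj : j < s + 1) :
    (approx μ s).toPoly ν (fun x => (monicOrth μ j).eval x) = monicOrth μ j := by
  have hnorm : √(∫ x, (monicOrth μ j).eval x ^ 2 ∂μ) ≠ 0 :=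
    (Real.sqrt_ne_zero (integral_nonneg fun x => sq_nonneg _)).mpr (hs j hj)
  rw [approx_toPoly_eval_apply hint, Finset.sum_eq_single_of_mem j (Finset.mem_range.mpr hj)]
  · rw [polyIntegral_monicOrth_mul_orthonormalPoly hint hs hj hj, if_pos rfl, orthonormalPoly,
      ← smul_eq_C_mul, smul_inv_smul₀ hnorm]
  · intro i hi hij
    rw [polyIntegral_monicOrth_mul_orthonormalPoly hint hs (Finset.mem_range.mp hi) hj, if_neg hij,
      zero_smul]

include hint in
theorem approx_toPoly_eval (hs : HasOrthogonalPolys μ (s + 1)) (ν : Measure ℝ) {p : ℝ[X]}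
    (hp : p.natDegree ≤ s) : (approx μ s).toPoly ν (fun x => p.eval x) = p := by
  set projection : ℝ[X] →ₗ[ℝ] ℝ[X] := ∑ i ∈ Finset.range (s + 1),
    (polyIntegral hint ∘ₗ LinearMap.mulRight ℝ (orthonormalPoly μ i)).smulRight
      (orthonormalPoly μ i) with hproj
  have happly : ∀ q, projection q = (approx μ s).toPoly ν fun x => q.eval x := fun q => by
    rw [approx_toPoly_eval_apply hint, hproj, LinearMap.sum_apply]
    rfl
  have hid : Set.EqOn projection (LinearMap.id : ℝ[X] →ₗ[ℝ] ℝ[X]) (degreeLT ℝ (s + 1)) := by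
    rw [← span_monicOrth μ]
    refine LinearMap.eqOn_span' ?_
    rintro _ ⟨j, hj, rfl⟩
    rw [happly, approx_toPoly_monicOrth hint hs ν hj, LinearMap.id_apply]
  rw [← happly, hid (mem_degreeLT.mpr (degree_lt_of_natDegree_le hp)), LinearMap.id_apply]

theorem integrable_approxDensity_mul {f : ℝ → ℝ}
    (hf : ∀ p : ℝ[X], Integrable (fun x => p.eval x * f x) μ) :
    Integrable (fun x => (∑ i ∈ Finset.range (s + 1),
      (∫ y, (orthonormalPoly μ i).eval y ∂ν) * (orthonormalPoly μ i).eval x) * f x) μ := by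
  simpa only [eval_finsetSum, eval_mul, eval_C] using hf (∑ i ∈ Finset.range (s + 1),
    C (∫ y, (orthonormalPoly μ i).eval y ∂ν) * orthonormalPoly μ i)

include hint in
theorem integrable_approxDensity :
    Integrable (fun x => ∑ i ∈ Finset.range (s + 1),
      (∫ y, (orthonormalPoly μ i).eval y ∂ν) * (orthonormalPoly μ i).eval x) μ := by
  simpa only [mul_one] using integrable_approxDensity_mul (f := fun _ => 1)
    fun p => by simpa only [mul_one] using hint p

include hint in
theorem integral_approxMeasure (hν : ∀ p : ℝ[X], Integrable (fun x => p.eval x) ν) {f : ℝ → ℝ}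
    (hf : ∀ p : ℝ[X], Integrable (fun x => p.eval x * f x) μ) :
    ∫ᵛ x, f x ∂•(approxMeasure μ s ν) = ∫ x, ((approx μ s).toPoly ν f).eval x ∂ν := by
  rw [approxMeasure, integral_withDensityᵥ (integrable_approxDensity hint)
    (integrable_approxDensity_mul hf), ← polyIntegral_apply hν]
  simp only [approx, map_sum, polyIntegral_C_mul]
  simp only [polyIntegral_apply, Finset.sum_mul, mul_assoc]
  rw [integral_finsetSum _ fun i _ => (hf _).const_mul _]
  refine Finset.sum_congr rfl fun i _ => ?_
  rw [integral_const_mul, mul_comm]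
  simp only [mul_comm (f _)]

end Approx

theorem isQuadratureMeasure_approxMeasure {μ ν : Measure ℝ} {a b : ℝ} {s : ℕ}
    (h : IsReference μ a b s) (hν : ∀ p : ℝ[X], Integrable (fun x => p.eval x) ν) {f : ℝ → ℝ}
    (hmeas : AEMeasurable f μ) (hf : Bornology.IsBounded (f '' Set.Icc a b)) :
    IsQuadratureMeasure (approx μ s) a b f ν (approxMeasure μ s ν) := by
  have hfp : ∀ p : ℝ[X], Integrable (fun x => p.eval x * f x) μ := fun p => by
    obtain ⟨C, hC⟩ := hf.exists_norm_le
    have hsupp : ∀ᵐ x ∂μ, x ∈ Set.Icc a b := h.supported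
    exact (h.integrable_eval p).mul_bdd hmeas.aestronglyMeasurable
      (hsupp.mono fun x hx => hC _ ⟨x, hx, rfl⟩)
  have hdensity := integrable_approxDensity (ν := ν) (s := s) h.integrable_eval
  refine ⟨ae_variation_withDensityᵥ hdensity h.supported,
    integrable_withDensityᵥ hdensity (integrable_approxDensity_mul hfp),
    integral_approxMeasure h.integrable_eval hν hfp, fun p hp => ?_⟩
  rw [integral_approxMeasure h.integrable_eval hν fun q => ?_,
    approx_toPoly_eval h.integrable_eval h.hasOrthogonalPolys ν hp]
  simpa only [eval_mul] using h.integrable_eval (q * p)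

end

end MatrixQuad

theorem mainTheorem2 {n nv : ℕ} (hn : 0 < n) (hnv : 0 < nv)
    (A : Matrix (Fin n) (Fin n) ℂ) (hA : A.IsHermitian)
    (a b : ℝ) (hspec : ∀ i, hA.eigenvalues i ∈ Set.Icc a b)
    (f : ℝ → ℝ) (fmin fmax : ℝ) (hf : ∀ x ∈ Set.Icc a b, fmin ≤ f x ∧ f x ≤ fmax)
    {Ω : Type*} [MeasurableSpace Ω] (P : Measure Ω) [IsProbabilityMeasure P]
    (v : Fin nv → Ω → Metric.sphere (0 : EuclideanSpace ℝ (Fin n)) 1)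
    (hlaw : ∀ l, HasLaw (v l) (unifSphere n) P) (hindep : iIndepFun v P)
    (Ψ : Ω → Fin nv → Measure ℝ) (hΨ : Ψ = fun ω l => weightedCESM hA (v l ω)) :
    -- every choice of the approximation operator
    (∀ (s : ℕ) (T : PolyApprox s),
      (∀ ε : ℝ, 0 < ε →
        P.real {ω | ‖(n : ℂ)⁻¹ * (hA.cfc f).trace - ((quadIntegral T (Ψ ω) f : ℝ) : ℂ)‖
            > ε + quadError T (Ψ ω) f}
          ≤ if fmin < fmax then
              2 * n * Real.exp (-(nv * (n + 2) * ε ^ 2 / (fmax - fmin) ^ 2))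
            else 0) ∧
      ∀ ω, quadError T (Ψ ω) f ≤
        (nv : ℝ)⁻¹ * ∑ l, uniformNorm a b (fun x => f x - (T.toPoly (Ψ ω l) f).eval x)) ∧
    -- Gaussian quadrature
    (∀ k : ℕ, 0 < k → ∀ ω,
      quadIntegral (gauss k) (Ψ ω) f
        = (∫ᵛ x, f x ∂•(avgSigned fun l => gaussMeasure k (Ψ ω l))) ∧
      quadError (gauss k) (Ψ ω) f ≤ 2 * bestError (2 * k - 1) a b f) ∧
    -- quadrature by interpolation
    (∀ (s : ℕ) (μ : Measure ℝ), IsReference μ a b s → ∀ ω,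
      quadIntegral (interp μ s) (Ψ ω) f
        = (∫ᵛ x, f x ∂•(avgSigned fun l => interpMeasure μ s (Ψ ω l))) ∧
      quadError (interp μ s) (Ψ ω) f
        ≤ (1 + dTV (avgSigned fun l => interpMeasure μ s (Ψ ω l))) * bestError s a b f) ∧
    -- quadrature by approximation
    (∀ (s : ℕ) (μ : Measure ℝ), IsReference μ a b s → AEMeasurable f μ → ∀ ω,
      quadIntegral (approx μ s) (Ψ ω) f
        = (∫ᵛ x, f x ∂•(avgSigned fun l => approxMeasure μ s (Ψ ω l))) ∧
      quadError (approx μ s) (Ψ ω) f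
        ≤ (1 + dTV (avgSigned fun l => approxMeasure μ s (Ψ ω l))) * bestError s a b f) := by
  subst hΨ
  have hbdd : Bornology.IsBounded (f '' Set.Icc a b) :=
    (Metric.isBounded_Icc fmin fmax).subset (Set.image_subset_iff.mpr hf)
  have hprob := fun ω l => isProbabilityMeasure_weightedCESM hA (norm_eq_of_mem_sphere (v l ω))
  have hsupp := fun ω l => ae_weightedCESM_mem hA hspec (v l ω)
  have hint := fun ω l => integrable_weightedCESM hA (v l ω) f
  have hpoly := fun ω l (p : ℝ[X]) => integrable_weightedCESM hA (v l ω) fun x => p.eval x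
  refine ⟨fun s T => ⟨fun ε hε => ?_, fun ω =>
      quadError_le_average_uniformNorm T (hsupp ω) (hint ω) hbdd⟩,
    fun k hk ω => ?_, fun s μ hμ ω => ?_, fun s μ hμ hmeas ω => ?_⟩
  · refine (measureReal_norm_trace_cfc_sub_quadIntegral_gt_le hA hn hnv hspec hf hlaw hindep T
      hε).trans ?_
    split_ifs
    · gcongr
      exact le_mul_of_one_le_right zero_le_two (Nat.one_le_cast.mpr hn)
    · exact le_rfl
  · have hgauss := fun l => isQuadratureMeasure_gaussMeasure (hsupp ω l) f hk
    have herror := quadError_le_mul_bestError hgauss hnv (hsupp ω) (hint ω) hbdd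
    rw [dTV_avgSigned_gaussMeasure hnv (hsupp ω) hk, one_add_one_eq_two] at herror
    exact ⟨quadIntegral_eq_integral_avgSigned hgauss, herror⟩
  · have hinterp := fun l => isQuadratureMeasure_interpMeasure hμ (hpoly ω l) f
    exact ⟨quadIntegral_eq_integral_avgSigned hinterp,
      quadError_le_mul_bestError hinterp hnv (hsupp ω) (hint ω) hbdd⟩
  · have happrox := fun l => isQuadratureMeasure_approxMeasure hμ (hpoly ω l) hmeas hbdd
    exact ⟨quadIntegral_eq_integral_avgSigned happrox,
      quadError_le_mul_bestError happrox hnv (hsupp ω) (hint ω) hbdd⟩
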